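/- **Model.** An instance has agents $N=\{1,\dots,n\}$, projects $M=\{1,\dots,m\}$, project costs $C_j\ge 0$, budgets $b_i\ge 0$, and monotone valuations $v_i:2^M\to\mathbb{R}_{\ge 0}$; write $C(W)=\sum_{j\in W}C_j$. An outcome $(W,x)$ consists of a set $W\subseteq M$ of funded projects and payments $x\in\mathbb{R}^N$. It is feasible if $x_i\le b_i$ for all $i$ and $C(W)\le\sum_{i\in N}x_i$, and it satisfies weak participation (WP) if $v_i(W)-x_i\ge 0$ for all $i$. Its social welfare is $\operatorname{SW}(W,x)=\sum_{i\in N}(v_i(W)-x_i)$. A UWO-WP outcome is one of maximum social welfare among the feasible outcomes that satisfy WP. Valuations are single-minded if for every agent $i$ there are a demand set $D_i\subseteq M$ and a value $z_i\ge 0$ with $v_i(W)=z_i$ if $D_i\subseteq W$ and $v_i(W)=0$ otherwise; they are laminar single-minded if moreover, for all $i,j\in N$, the set $D_i\cap D_j$ is empty or equal to $D_i$ or to $D_j$. **Theorem.** For laminar single-minded valuations, the problem of finding a UWO-WP outcome admits an FPTAS. That is, there are a single algorithm and a polynomial $p$ such that, for every instance $I$ with laminar single-minded valuations, given by $n$,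 $m$, the demand sets $D_i$ and rational numbers $z_i,b_i,C_j\ge 0$ (numerators and denominators in binary), and every real $\varepsilon>0$, the algorithm on input $I$ and $\lceil 1/\varepsilon\rceil$ runs in time at most $p(|I|,1/\varepsilon)$, where $|I|$ is the bit length of $I$, and outputs a feasible outcome $(W,x)$ satisfying WP with $$\operatorname{SW}(W,x)\ \ge\ (1-\varepsilon)\,\operatorname{SW}(W^\star,x^\star),$$ where $(W^\star,x^\star)$ is a UWO-WP outcome of $I$ (one always exists). Running time is measured on a random access machine with logarithmic cost. -/

import Mathlib

/-!
## Participatory budgeting with resource pooling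
-/

/-- An instance with agents `Fin n` and projects `Fin m`: monotone nonnegative valuations on
bundles, nonnegative budgets, nonnegative project costs. -/
structure PBInstance (n m : ℕ) where
  /-- valuation of a bundle by an agent -/
  v : Fin n → Finset (Fin m) → ℝ
  /-- budgets -/
  b : Fin n → ℝ
  /-- project costs -/
  C : Fin m → ℝ
  v_nonneg : ∀ i S, 0 ≤ v i S
  v_mono : ∀ i S T, S ⊆ T → v i S ≤ v i T
  b_nonneg : ∀ i, 0 ≤ b i
  C_nonneg : ∀ j, 0 ≤ C j

/-- A set of funded projects together with the payments of the agents. -/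
structure PBOutcome (n m : ℕ) where
  /-- funded projects -/
  W : Finset (Fin m)
  /-- payments -/
  x : Fin n → ℝ

namespace PBInstance

variable {n m : ℕ}

/-- Total cost of a bundle. -/
def cost (I : PBInstance n m) (S : Finset (Fin m)) : ℝ := ∑ j ∈ S, I.C j

/-- Quasi-linear utility of agent `i`. -/
def utility (I : PBInstance n m) (o : PBOutcome n m) (i : Fin n) : ℝ := I.v i o.W - o.x i

/-- Weak budget balance: the payments cover the cost of the funded projects. -/
def WBB (I : PBInstance n m) (o : PBOutcome n m) : Prop := I.cost o.W ≤ ∑ i, o.x i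

/-- No payment exceeds the budget of the agent, and weak budget balance holds. -/
def Feasible (I : PBInstance n m) (o : PBOutcome n m) : Prop :=
  (∀ i, o.x i ≤ I.b i) ∧ I.WBB o

/-- Weak participation: every agent has nonnegative utility. -/
def WP (I : PBInstance n m) (o : PBOutcome n m) : Prop := ∀ i, 0 ≤ I.utility o i

/-- Utilitarian social welfare. -/
def SW (I : PBInstance n m) (o : PBOutcome n m) : ℝ := ∑ i, I.utility o i

/-- Welfare optimal among the feasible outcomes that satisfy weak participation. -/
def IsUWOWP (I : PBInstance n m) (o : PBOutcome n m) : Prop :=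
  I.Feasible o ∧ I.WP o ∧ ∀ o' : PBOutcome n m, I.Feasible o' → I.WP o' → I.SW o' ≤ I.SW o

end PBInstance

/-- The finite data describing an instance with single-minded valuations: agent `i` has value
`z i` for every bundle that contains the demand set `D i`, and value zero for all others.
The numbers are rational. -/
structure SingleMinded where
  /-- number of agents -/
  n : ℕ
  /-- number of projects -/
  m : ℕ
  /-- demand sets -/
  D : Fin n → Finset (Fin m)
  /-- values of the demand sets -/
  z : Fin n → ℚ≥0
  /-- budgets -/
  b : Fin n → ℚ≥0
  /-- project costs -/
  C : Fin m → ℚ≥0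

namespace SingleMinded

/-- The instance with single-minded valuations described by the data. -/
def toInstance (I : SingleMinded) : PBInstance I.n I.m where
  v i W := if I.D i ⊆ W then (I.z i : ℝ) else 0
  b i := (I.b i : ℝ)
  C j := (I.C j : ℝ)
  v_nonneg i S := by
    split_ifs
    · exact NNRat.cast_nonneg _
    · exact le_rfl
  v_mono i S T h := by
    split_ifs with h1 h2
    · exact le_rfl
    · exact absurd (h1.trans h) h2
    · exact NNRat.cast_nonneg _
    · exact le_rfl
  b_nonneg _ := NNRat.cast_nonneg _
  C_nonneg _ := NNRat.cast_nonneg _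

/-- The demand sets form a laminar family. -/
def Laminar (I : SingleMinded) : Prop :=
  ∀ i j, I.D i ∩ I.D j = ∅ ∨ I.D i ∩ I.D j = I.D i ∨ I.D i ∩ I.D j = I.D j

/-- Number of bits of the binary encoding of a fraction. -/
def bits (q : ℚ≥0) : ℕ := q.num.size + q.den.size

/-- Number of bits of the instance: the numbers of agents and projects, values, budgets and costs
are written in binary, and the demand sets as a 0/1 matrix. -/
def size (I : SingleMinded) : ℕ :=
  I.n.size + I.m.size + I.n * I.m + (∑ i, (bits (I.z i) + bits (I.b i))) + ∑ j, bits (I.C j)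

end SingleMinded

/-!
## Random access machine with logarithmic cost

Structured programs over registers and arrays that hold natural numbers of arbitrary size. Every
operation is charged the bit lengths of the numbers that it involves (operands, result and
addresses), so that the cost is polynomially related to the running time of Turing machines.
-/

namespace RAM

/-- Memory contents: register `x` holds `reg x`, cell `k` of array `a` holds `arr a k`. -/
structure Store where
  /-- registers -/
  reg : ℕ → ℕ
  /-- arrays -/
  arr : ℕ → ℕ → ℕ

/-- Arithmetic expressions; subtraction is truncated, division is rounded down. -/
inductive Exp where
  | lit (k : ℕ)
  | var (x : ℕ)
  | get (a : ℕ) (e : Exp)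
  | add (e f : Exp)
  | sub (e f : Exp)
  | mul (e f : Exp)
  | div (e f : Exp)

/-- Value of an expression. -/
def Exp.eval (s : Store) : Exp → ℕ
  | .lit k => k
  | .var x => s.reg x
  | .get a e => s.arr a (e.eval s)
  | .add e f => e.eval s + f.eval s
  | .sub e f => e.eval s - f.eval s
  | .mul e f => e.eval s * f.eval s
  | .div e f => e.eval s / f.eval s

/-- Logarithmic cost of evaluating an expression: every node of the expression is charged one plus
the bit length of its value. -/
def Exp.cost (s : Store) : Exp → ℕ
  | .lit k => k.size + 1
  | .var x => (s.reg x).size + 1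
  | .get a e => e.cost s + (s.arr a (e.eval s)).size + 1
  | .add e f => e.cost s + f.cost s + (e.eval s + f.eval s).size + 1
  | .sub e f => e.cost s + f.cost s + (e.eval s - f.eval s).size + 1
  | .mul e f => e.cost s + f.cost s + (e.eval s * f.eval s).size + 1
  | .div e f => e.cost s + f.cost s + (e.eval s / f.eval s).size + 1

/-- Programs. -/
inductive Cmd where
  | skip
  /-- write the value of `e` to register `x` -/
  | assign (x : ℕ) (e : Exp)
  /-- write the value of `f` to cell number `e` of array `a` -/
  | put (a : ℕ) (e f : Exp)
  | seq (p q : Cmd)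
  /-- run `p` if `e` is nonzero, and `q` otherwise -/
  | ite (e : Exp) (p q : Cmd)
  /-- repeat `p` as long as `e` is nonzero -/
  | loop (e : Exp) (p : Cmd)

/-- Write to a register. -/
def Store.setReg (s : Store) (x k : ℕ) : Store :=
  { s with reg := Function.update s.reg x k }

/-- Write to a cell of an array. -/
def Store.setArr (s : Store) (a i k : ℕ) : Store :=
  { s with arr := Function.update s.arr a (Function.update (s.arr a) i k) }

/-- `Exec p s t s'`: the program `p`, started in `s`, halts in `s'` after a run of cost `t`. -/
inductive Exec : Cmd → Store → ℕ → Store → Prop where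
  | skip (s : Store) : Exec .skip s 1 s
  | assign (s : Store) (x : ℕ) (e : Exp) :
      Exec (.assign x e) s (e.cost s + 1) (s.setReg x (e.eval s))
  | put (s : Store) (a : ℕ) (e f : Exp) :
      Exec (.put a e f) s (e.cost s + f.cost s + 1) (s.setArr a (e.eval s) (f.eval s))
  | seq {p q : Cmd} {s s₁ s₂ : Store} {t₁ t₂ : ℕ} :
      Exec p s t₁ s₁ → Exec q s₁ t₂ s₂ → Exec (.seq p q) s (t₁ + t₂) s₂
  | ite_true {e : Exp} {p q : Cmd} {s s₁ : Store} {t : ℕ} :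
      e.eval s ≠ 0 → Exec p s t s₁ → Exec (.ite e p q) s (e.cost s + 1 + t) s₁
  | ite_false {e : Exp} {p q : Cmd} {s s₁ : Store} {t : ℕ} :
      e.eval s = 0 → Exec q s t s₁ → Exec (.ite e p q) s (e.cost s + 1 + t) s₁
  | loop_true {e : Exp} {p : Cmd} {s s₁ s₂ : Store} {t₁ t₂ : ℕ} :
      e.eval s ≠ 0 → Exec p s t₁ s₁ → Exec (.loop e p) s₁ t₂ s₂ →
      Exec (.loop e p) s (e.cost s + 1 + t₁ + t₂) s₂
  | loop_false {e : Exp} {p : Cmd} {s : Store} :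
      e.eval s = 0 → Exec (.loop e p) s (e.cost s + 1) s

/-- The array that holds the given values in its first cells and zeros in all others. -/
def ofFin {n : ℕ} (f : Fin n → ℕ) (k : ℕ) : ℕ := if h : k < n then f ⟨k, h⟩ else 0

end RAM

namespace SingleMinded

open RAM

/-- The initial memory for the instance `I` and the accuracy parameter `k`: registers 0, 1, 2 hold
`n`, `m`, `k`; arrays 0 to 5 hold the numerators and denominators of the values, budgets and costs;
cell `i * m + j` of array 6 is 1 if project `j` is in the demand set of agent `i`.
All other registers and cells are 0. -/
def input (I : SingleMinded) (k : ℕ) : Store where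
  reg
    | 0 => I.n
    | 1 => I.m
    | 2 => k
    | _ => 0
  arr
    | 0 => ofFin fun i => (I.z i).num
    | 1 => ofFin fun i => (I.z i).den
    | 2 => ofFin fun i => (I.b i).num
    | 3 => ofFin fun i => (I.b i).den
    | 4 => ofFin fun j => (I.C j).num
    | 5 => ofFin fun j => (I.C j).den
    | 6 => fun p =>
        if ∃ (i : Fin I.n) (j : Fin I.m), p = (i : ℕ) * I.m + (j : ℕ) ∧ j ∈ I.D i then 1 else 0
    | _ => fun _ => 0

/-- The final memory `s` contains the outcome `o`: cell `j` of array 7 is nonzero exactly for the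
funded projects `j`, and the payment of agent `i` is the fraction with numerator in cell `i` of
array 8 and nonzero denominator in cell `i` of array 9. -/
def IsOutput (I : SingleMinded) (s : Store) (o : PBOutcome I.n I.m) : Prop :=
  (∀ j : Fin I.m, j ∈ o.W ↔ s.arr 7 j ≠ 0) ∧
  ∀ i : Fin I.n, s.arr 9 i ≠ 0 ∧ o.x i = (s.arr 8 i : ℝ) / (s.arr 9 i : ℝ)

end SingleMinded

/-! Reduction to bundles: weak participation and the budget cap what agent `i` pays at `min z_i b_i`
if its demand set is funded, and at zero otherwise. So a bundle can be financed exactly if its cost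
is at most the sum of the caps of the agents it satisfies, and collecting no more than the cost
makes the welfare equal to value minus cost (`welfare_le`, `exists_outcome`). What remains is a
maximization over finitely many bundles, which also gives an optimum (`exists_optimal`).
Multiplication by a common denominator makes all data integral.

Laminarity: the agents satisfied by a bundle lie below its maximal demand sets, and these are
pairwise disjoint. Their union costs no more than the bundle and satisfies the same agents, so
families of disjoint demand sets suffice (`exists_maximal`). A member whose value does not exceed
its cost may be dropped: the caps are at most the values, so it contributes neither welfare nor
budget surplus. Agents with empty demand sets are always satisfied and are counted apart.

This leaves a knapsack problem: maximize total gain subject to nonnegative surplus. Guess the member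
`g` of largest gain and round all gains down to multiples of `gain g / (n * k)`. There are then only
`n * n * k + 1` rounded totals, and rounding loses at most a `1 / k` fraction of the optimum
(`approx_aux`, `approx`). For each total, a dynamic program finds the largest surplus.

Disjointness is kept by an interval order. The projects are sorted by their membership vectors, read
as binary numbers in which larger demand sets have more significant bits. Disjoint members of a
laminar family are then separated (`separated`), so a family of disjoint sets is a chain of
intervals and can be built from left to right. `exists_fam` and `le_cell` are soundness and
optimality of the table.

Running time: a calculus of polynomial-time functions into the naturals is closed under arithmetic,
bounded sums, products and maxima, and iteration with polynomially long intermediate values. Loop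
bounds and indices must be polynomial in value, other numbers only in bit length; the accuracy
counts by its value. The table is a single number whose digits are the entries, so course-of-values
recursion is an iteration (`PolyTime.recTable`). -/

namespace RAM

/-!
## Polynomial-time functions

A function is computed in a context: an instance with an accuracy parameter, followed by local
variables. Programs find the variables of the context in the registers of a list, and use the
registers from a given number on as scratch memory.
-/

/-- What the machine is started on. -/
structure Query where
  /-- the instance -/
  inst : SingleMinded
  /-- the accuracy parameter -/
  acc : ℕ

/-- A number whose contribution to the size of a context is its bit length. -/
structure Word where
  /-- the number -/
  val : ℕ

/-- Types of contexts. -/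
class Ctx (α : Type) where
  /-- the underlying query -/
  query : α → Query
  /-- size of the context -/
  meas : α → ℕ
  /-- the memory holds the query, and the variables of the context in the registers of the list -/
  Holds : List ℕ → Store → α → Prop
  size_le : ∀ a, (query a).inst.size + (query a).acc ≤ meas a
  reads : ∀ {l s a}, Holds l s a → (∀ r < 3, s.reg r = ((query a).inst.input (query a).acc).reg r) ∧
    ∀ c < 7, s.arr c = ((query a).inst.input (query a).acc).arr c
  frame : ∀ {l s s' a b}, Holds l s a → 3 ≤ b → (∀ r ∈ l, r < b) →
    (∀ r < b, s'.reg r = s.reg r) → (∀ c < 7, s'.arr c = s.arr c) → Holds l s' a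

instance : Ctx Query where
  query q := q
  meas q := q.inst.size + q.acc
  Holds l s q := l = [] ∧ (∀ r < 3, s.reg r = (q.inst.input q.acc).reg r) ∧
    ∀ c < 7, s.arr c = (q.inst.input q.acc).arr c
  size_le _ := le_rfl
  reads h := h.2
  frame h hb _ hr hc :=
    ⟨h.1, fun r h3 => (hr r (h3.trans_le hb)).trans (h.2.1 r h3),
      fun c h7 => (hc c h7).trans (h.2.2 c h7)⟩

instance {α : Type} [Ctx α] : Ctx (α × ℕ) where
  query a := Ctx.query a.1
  meas a := Ctx.meas a.1 + a.2
  Holds l s a := ∃ r l', l = r :: l' ∧ s.reg r = a.2 ∧ Ctx.Holds l' s a.1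
  size_le a := (Ctx.size_le a.1).trans (Nat.le_add_right _ _)
  reads := fun ⟨_, _, _, _, h⟩ => Ctx.reads h
  frame := by
    rintro l s s' a b ⟨r, l', rfl, h1, h2⟩ hb hl hr hc
    exact ⟨r, l', rfl, (hr r (hl r (by simp))).trans h1,
      Ctx.frame h2 hb (fun x hx => hl x (by simp [hx])) hr hc⟩

instance {α : Type} [Ctx α] : Ctx (α × Word) where
  query a := Ctx.query a.1
  meas a := Ctx.meas a.1 + a.2.val.size
  Holds l s a := ∃ r l', l = r :: l' ∧ s.reg r = a.2.val ∧ Ctx.Holds l' s a.1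
  size_le a := (Ctx.size_le a.1).trans (Nat.le_add_right _ _)
  reads := fun ⟨_, _, _, _, h⟩ => Ctx.reads h
  frame := by
    rintro l s s' a b ⟨r, l', rfl, h1, h2⟩ hb hl hr hc
    exact ⟨r, l', rfl, (hr r (hl r (by simp))).trans h1,
      Ctx.frame h2 hb (fun x hx => hl x (by simp [hx])) hr hc⟩

open Ctx

variable {α : Type} [Ctx α]

/-- The value is bounded by a polynomial in the size of the context. -/
def PolyBdd (g : α → ℕ) : Prop := ∃ K, ∀ a, g a ≤ (meas a + 2) ^ K

namespace PolyBdd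

theorem mono {f g : α → ℕ} (hg : PolyBdd g) (h : ∀ a, f a ≤ g a) : PolyBdd f :=
  let ⟨K, hK⟩ := hg
  ⟨K, fun a => (h a).trans (hK a)⟩

theorem const (c : ℕ) : PolyBdd (fun _ : α => c) :=
  ⟨c, fun a => (Nat.lt_two_pow_self (n := c)).le.trans (Nat.pow_le_pow_left (by omega) _)⟩

theorem meas : PolyBdd (Ctx.meas : α → ℕ) := ⟨1, fun a => by simp⟩

theorem mul {f g : α → ℕ} (hf : PolyBdd f) (hg : PolyBdd g) : PolyBdd (fun a => f a * g a) :=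
  let ⟨K, hK⟩ := hf
  let ⟨L, hL⟩ := hg
  ⟨K + L, fun a => by rw [pow_add]; exact Nat.mul_le_mul (hK a) (hL a)⟩

theorem add {f g : α → ℕ} (hf : PolyBdd f) (hg : PolyBdd g) : PolyBdd (fun a => f a + g a) := by
  obtain ⟨K, hK⟩ := hf
  obtain ⟨L, hL⟩ := hg
  refine ⟨max K L + 1, fun a => ?_⟩
  have h1 : f a ≤ (Ctx.meas a + 2) ^ max K L :=
    (hK a).trans (Nat.pow_le_pow_right (by omega) (le_max_left _ _))
  have h2 : g a ≤ (Ctx.meas a + 2) ^ max K L :=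
    (hL a).trans (Nat.pow_le_pow_right (by omega) (le_max_right _ _))
  rw [pow_succ]
  nlinarith [Nat.zero_le (Ctx.meas a * (Ctx.meas a + 2) ^ max K L)]

/-- Polynomials are closed under composition. -/
theorem comp {β : Type} [Ctx β] {f : β → ℕ} (hf : PolyBdd f) {g : α → ℕ} (hg : PolyBdd g) :
    ∃ M : α → ℕ, PolyBdd M ∧ ∀ a b, Ctx.meas b ≤ g a → f b ≤ M a := by
  obtain ⟨K, hK⟩ := hf
  obtain ⟨L, hL⟩ := hg
  -- The exponent comes from `x ^ L + 2 ≤ x ^ (L + 2)` for `x ≥ 2`, applied to `x = meas a + 2`.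
  refine ⟨_, ⟨(L + 2) * K, fun a => le_rfl⟩, fun a b hb => (hK b).trans ?_⟩
  rw [pow_mul]
  refine Nat.pow_le_pow_left ?_ _
  have h1 := hL a
  have h2 : 1 ≤ (Ctx.meas a + 2) ^ L := Nat.one_le_pow _ _ (by omega)
  have h3 : 2 ^ 2 ≤ (Ctx.meas a + 2) ^ 2 := Nat.pow_le_pow_left (by omega) _
  rw [pow_add]
  nlinarith

theorem fst {g : α → ℕ} (hg : PolyBdd g) : PolyBdd (fun a : α × ℕ => g a.1) :=
  let ⟨K, hK⟩ := hg
  ⟨K, fun a => (hK a.1).trans (Nat.pow_le_pow_left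
    (Nat.add_le_add_right (Nat.le_add_right _ _) _) _)⟩

theorem fstWord {g : α → ℕ} (hg : PolyBdd g) : PolyBdd (fun a : α × Word => g a.1) :=
  let ⟨K, hK⟩ := hg
  ⟨K, fun a => (hK a.1).trans (Nat.pow_le_pow_left
    (Nat.add_le_add_right (Nat.le_add_right _ _) _) _)⟩

end PolyBdd

/-! ### Bit lengths and the notion of a polynomial-time function -/

theorem size_add_le (x y : ℕ) : (x + y).size ≤ x.size + y.size + 1 := by
  rw [Nat.size_le]
  have hx := Nat.lt_size_self x
  have hy := Nat.lt_size_self y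
  have h1 : 2 ^ x.size ≤ 2 ^ (x.size + y.size) := Nat.pow_le_pow_right (by omega) (by omega)
  have h2 : 2 ^ y.size ≤ 2 ^ (x.size + y.size) := Nat.pow_le_pow_right (by omega) (by omega)
  rw [pow_succ]; omega

theorem size_mul_le (x y : ℕ) : (x * y).size ≤ x.size + y.size := by
  rw [Nat.size_le, pow_add]
  exact Nat.mul_lt_mul'' (Nat.lt_size_self x) (Nat.lt_size_self y)

theorem size_le_self (x : ℕ) : x.size ≤ x := by
  rw [Nat.size_le]; exact Nat.lt_two_pow_self

/-- The program `p` computes `f` at cost at most `T`: it finds the context in the registers `l` and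
writes the value to register `b`, and it leaves the lower registers and the arrays alone. -/
def Computes (p : Cmd) (l : List ℕ) (b : ℕ) (f T : α → ℕ) : Prop :=
  ∀ a s, Holds l s a → ∃ t s', Exec p s t s' ∧ s'.reg b = f a ∧
    (∀ r < b, s'.reg r = s.reg r) ∧ s'.arr = s.arr ∧ t ≤ T a

/-- Functions that are computed in time polynomial in the size of the context. -/
def PolyTime (f : α → ℕ) : Prop :=
  PolyBdd (fun a => (f a).size) ∧ ∀ l b, 3 ≤ b → (∀ r ∈ l, r < b) →
    ∃ p T, PolyBdd T ∧ Computes p l b f T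

/-- Functions with small values that are computed in polynomial time. -/
def Small (f : α → ℕ) : Prop := PolyTime f ∧ PolyBdd f

@[simp] theorem setReg_same (s : Store) (x k : ℕ) : (s.setReg x k).reg x = k := by
  simp [Store.setReg]

theorem setReg_ne (s : Store) {x y : ℕ} (k : ℕ) (h : y ≠ x) : (s.setReg x k).reg y = s.reg y := by
  simp [Store.setReg, h]

@[simp] theorem setReg_arr (s : Store) (x k : ℕ) : (s.setReg x k).arr = s.arr := rfl

@[simp] theorem setArr_reg (s : Store) (a i k : ℕ) : (s.setArr a i k).reg = s.reg := rfl

/-! ### Machine operations and bounded iteration -/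

namespace PolyTime

theorem congr {f g : α → ℕ} (hf : PolyTime f) (h : ∀ a, f a = g a) : PolyTime g :=
  (funext h : f = g) ▸ hf

/-- A single assignment. -/
theorem of_exp {f : α → ℕ} (hs : PolyBdd (fun a => (f a).size))
    (h : ∀ l b, 3 ≤ b → (∀ r ∈ l, r < b) → ∃ (e : Exp) (T : α → ℕ), PolyBdd T ∧
      ∀ a s, Holds l s a → e.eval s = f a ∧ e.cost s ≤ T a) : PolyTime f := by
  refine ⟨hs, fun l b hb hl => ?_⟩
  obtain ⟨e, T, hT, he⟩ := h l b hb hl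
  refine ⟨.assign b e, fun a => T a + 1, hT.add (.const 1), fun a s hs => ?_⟩
  obtain ⟨h1, h2⟩ := he a s hs
  exact ⟨_, _, .assign s b e, by simp [h1], fun r hr => setReg_ne _ _ hr.ne, rfl,
    Nat.add_le_add_right h2 1⟩

theorem const (c : ℕ) : PolyTime (fun _ : α => c) :=
  of_exp (.const _) fun _ _ _ _ => ⟨.lit c, _, .const (c.size + 1), fun _ _ _ => ⟨rfl, le_rfl⟩⟩

theorem snd : PolyTime (fun a : α × ℕ => a.2) := by
  have hs : PolyBdd (fun a : α × ℕ => a.2.size) :=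
    PolyBdd.meas.mono fun a => (size_le_self _).trans (Nat.le_add_left _ _)
  refine of_exp hs fun l b hb hl => ?_
  refine ⟨.var l.head!, _, hs.add (.const 1), ?_⟩
  rintro a s ⟨r, l', rfl, h1, -⟩
  simp [Exp.eval, Exp.cost, h1]

theorem word : PolyTime (fun a : α × Word => a.2.val) := by
  have hs : PolyBdd (fun a : α × Word => a.2.val.size) :=
    PolyBdd.meas.mono fun a => Nat.le_add_left _ _
  refine of_exp hs fun l b hb hl => ?_
  refine ⟨.var l.head!, _, hs.add (.const 1), ?_⟩
  rintro a s ⟨r, l', rfl, h1, -⟩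
  simp [Exp.eval, Exp.cost, h1]

/-- Weakening by a small variable. -/
theorem fst {f : α → ℕ} (hf : PolyTime f) : PolyTime (fun a : α × ℕ => f a.1) := by
  refine ⟨hf.1.fst, fun l b hb hl => ?_⟩
  cases l with
  -- A pair is never held by the empty list, so any program will do.
  | nil => exact ⟨.skip, _, .const 0, fun a s ⟨r, l', h, _⟩ => by simp at h⟩
  | cons r l =>
    obtain ⟨p, T, hT, hp⟩ := hf.2 l b hb fun x hx => hl x (by simp [hx])
    refine ⟨p, fun a => T a.1, hT.fst, ?_⟩
    rintro a s ⟨r', l', h, -, h2⟩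
    obtain ⟨rfl, rfl⟩ := List.cons.inj h
    exact hp a.1 s h2

/-- Weakening by a word. -/
theorem fstWord {f : α → ℕ} (hf : PolyTime f) : PolyTime (fun a : α × Word => f a.1) := by
  refine ⟨hf.1.fstWord, fun l b hb hl => ?_⟩
  cases l with
  | nil => exact ⟨.skip, _, .const 0, fun a s ⟨r, l', h, _⟩ => by simp at h⟩
  | cons r l =>
    obtain ⟨p, T, hT, hp⟩ := hf.2 l b hb fun x hx => hl x (by simp [hx])
    refine ⟨p, fun a => T a.1, hT.fstWord, ?_⟩
    rintro a s ⟨r', l', h, -, h2⟩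
    obtain ⟨rfl, rfl⟩ := List.cons.inj h
    exact hp a.1 s h2

/-- Applying an operation of the machine to the value of a function. -/
theorem unop {f g : α → ℕ} (hf : PolyTime f) (hg : PolyBdd (fun a => (g a).size))
    (op : Exp → Exp) (T : α → ℕ) (hT : PolyBdd T)
    (hop : ∀ l s a e, Holds l s a → e.eval s = f a → (op e).eval s = g a ∧
      (op e).cost s ≤ e.cost s + T a) : PolyTime g := by
  refine ⟨hg, fun l b hb hl => ?_⟩
  obtain ⟨p, T₁, hT₁, hp⟩ := hf.2 l b hb hl
  refine ⟨.seq p (.assign b (op (.var b))), fun a => T₁ a + ((f a).size + 1 + T a + 1),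
    hT₁.add (((hf.1.add (.const 1)).add hT).add (.const 1)), fun a s hs => ?_⟩
  obtain ⟨t, s₁, he, hv, hr, ha, ht⟩ := hp a s hs
  have hs₁ : Holds l s₁ a := Ctx.frame hs hb hl hr fun c _ => by rw [ha]
  obtain ⟨h1, h2⟩ := hop l s₁ a (.var b) hs₁ hv
  refine ⟨_, _, .seq he (.assign s₁ b _), by simp [h1],
    fun r h => (setReg_ne _ _ h.ne).trans (hr r h), ha, ?_⟩
  simp only [Exp.cost, hv] at h2
  show _ ≤ T₁ a + ((f a).size + 1 + T a + 1)
  omega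

/-- Applying an operation of the machine to the values of two functions. -/
theorem binop {f g : α → ℕ} (hf : PolyTime f) (hg : PolyTime g) (F : ℕ → ℕ → ℕ)
    (op : Exp → Exp → Exp) (hsz : ∀ x y, (F x y).size ≤ x.size + y.size + 1)
    (hop : ∀ s d e, (op d e).eval s = F (d.eval s) (e.eval s) ∧
      (op d e).cost s = d.cost s + e.cost s + (F (d.eval s) (e.eval s)).size + 1) :
    PolyTime (fun a => F (f a) (g a)) := by
  refine ⟨((hf.1.add hg.1).add (.const 1)).mono fun a => hsz _ _, fun l b hb hl => ?_⟩
  obtain ⟨p, T₁, hT₁, hp⟩ := hf.2 l b hb hl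
  obtain ⟨q, T₂, hT₂, hq⟩ := hg.2 l (b + 1) (by omega) fun r hr => (hl r hr).trans (by omega)
  refine ⟨.seq p (.seq q (.assign b (op (.var b) (.var (b + 1))))),
    fun a => T₁ a + T₂ a + 2 * ((f a).size + (g a).size) + 5,
    ((hT₁.add hT₂).add ((PolyBdd.const 2).mul (hf.1.add hg.1))).add (.const 5), fun a s hs => ?_⟩
  obtain ⟨t, s₁, he, hv, hr, ha, ht⟩ := hp a s hs
  have hs₁ : Holds l s₁ a := Ctx.frame hs hb hl hr fun c _ => by rw [ha]
  obtain ⟨t₂, s₂, he₂, hv₂, hr₂, ha₂, ht₂⟩ := hq a s₁ hs₁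
  have hb₂ : s₂.reg b = f a := (hr₂ b (by omega)).trans hv
  obtain ⟨h1, h2⟩ := hop s₂ (.var b) (.var (b + 1))
  simp only [Exp.eval, Exp.cost, hb₂, hv₂] at h1 h2
  refine ⟨_, _, .seq he (.seq he₂ (.assign s₂ b _)), by simp [h1],
    fun r h => (setReg_ne _ _ h.ne).trans ((hr₂ r (by omega)).trans (hr r h)), ha₂.trans ha, ?_⟩
  have := hsz (f a) (g a)
  rw [h2]
  show _ ≤ T₁ a + T₂ a + 2 * ((f a).size + (g a).size) + 5
  omega

theorem add {f g : α → ℕ} (hf : PolyTime f) (hg : PolyTime g) : PolyTime (fun a => f a + g a) :=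
  hf.binop hg (· + ·) .add size_add_le fun _ _ _ => ⟨rfl, rfl⟩

theorem sub {f g : α → ℕ} (hf : PolyTime f) (hg : PolyTime g) : PolyTime (fun a => f a - g a) :=
  hf.binop hg (· - ·) .sub
    (fun x y => (Nat.size_le_size (Nat.sub_le x y)).trans (by omega)) fun _ _ _ => ⟨rfl, rfl⟩

theorem mul {f g : α → ℕ} (hf : PolyTime f) (hg : PolyTime g) : PolyTime (fun a => f a * g a) :=
  hf.binop hg (· * ·) .mul
    (fun x y => (size_mul_le x y).trans (by omega)) fun _ _ _ => ⟨rfl, rfl⟩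

theorem div {f g : α → ℕ} (hf : PolyTime f) (hg : PolyTime g) : PolyTime (fun a => f a / g a) :=
  hf.binop hg (· / ·) .div
    (fun x y => (Nat.size_le_size (Nat.div_le_self x y)).trans (by omega)) fun _ _ _ => ⟨rfl, rfl⟩

/-- Iteration, provided that the intermediate values have polynomial size. -/
theorem iter {c init : α → ℕ} {h : α → ℕ → ℕ → ℕ} (hc : Small c) (hi : PolyTime init)
    (hh : PolyTime (fun p : (α × ℕ) × Word => h p.1.1 p.1.2 p.2.val))
    {G : α → ℕ} (hG : PolyBdd G)
    (hsz : ∀ a, ∀ i ≤ c a, (Nat.rec (init a) (h a) i : ℕ).size ≤ G a) :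
    PolyTime (fun a => (Nat.rec (init a) (h a) (c a) : ℕ)) := by
  refine ⟨hG.mono fun a => hsz a _ le_rfl, fun l b hb hl => ?_⟩
  -- Register `b` holds the number of rounds, `b + 1` the counter, `b + 2` the accumulator; the step
  -- function writes to `b + 3`.
  obtain ⟨pc, Tc, hTc, hpc⟩ := hc.1.2 l b hb hl
  obtain ⟨pi, Ti, hTi, hpi⟩ := hi.2 l (b + 2) (by omega) fun r hr => (hl r hr).trans (by omega)
  have hl' : ∀ r ∈ (b + 2) :: (b + 1) :: l, r < b + 3 := by
    intro r hr
    rcases List.mem_cons.1 hr with rfl | hr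
    · omega
    rcases List.mem_cons.1 hr with rfl | hr
    · omega
    · exact (hl r hr).trans (by omega)
  obtain ⟨ph, Th, hTh, hph⟩ := hh.2 ((b + 2) :: (b + 1) :: l) (b + 3) (by omega) hl'
  have hcb : PolyBdd c := hc.2
  -- The context of the step exceeds `a` only by a counter at most `c a` and an accumulator of bit
  -- length at most `G a`, so one polynomial bound `M` serves all rounds.
  obtain ⟨M, hM, hThM⟩ := hTh.comp ((PolyBdd.meas (α := α)).add (hcb.add hG))
  set acc : α → ℕ → ℕ := fun a i => Nat.rec (init a) (h a) i with hacc
  let e : Exp := .sub (.var b) (.var (b + 1))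
  let body : Cmd := .seq ph (.seq (.assign (b + 2) (.var (b + 3)))
    (.assign (b + 1) (.add (.var (b + 1)) (.lit 1))))
  let R : α → ℕ := fun a => M a + 10 * c a + G a + 20
  have hR : PolyBdd R := ((hM.add ((PolyBdd.const 10).mul hcb)).add hG).add (.const 20)
  have hloop : ∀ a s d, d ≤ c a → Holds l s a → s.reg b = c a → s.reg (b + 1) = c a - d →
      s.reg (b + 2) = acc a (c a - d) →
      ∃ t s', Exec (.loop e body) s t s' ∧ s'.reg (b + 2) = acc a (c a) ∧
        (∀ r < b, s'.reg r = s.reg r) ∧ s'.arr = s.arr ∧ t ≤ (d + 1) * R a := by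
    intro a s d
    induction d generalizing s with
    | zero =>
      intro _ hs h0 h1 h2
      have hs1 := size_le_self (c a)
      refine ⟨_, s, .loop_false (by simp [e, Exp.eval, h0, h1]), by simpa using h2, fun _ _ => rfl,
        rfl, ?_⟩
      simp only [e, Exp.cost, Exp.eval, h0, h1, R]
      simp only [Nat.sub_zero, Nat.sub_self, Nat.size_zero]
      omega
    | succ d ih =>
      intro hd hs h0 h1 h2
      have hH : Holds ((b + 2) :: (b + 1) :: l) s
          ((a, c a - (d + 1)), Word.mk (acc a (c a - (d + 1)))) :=
        ⟨_, _, rfl, h2, _, _, rfl, h1, hs⟩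
      obtain ⟨t, s₁, he, hv, hr, ha, ht⟩ := hph _ s hH
      simp only at hv
      have hcd : c a - d = c a - (d + 1) + 1 := by omega
      have hacc' : h a (c a - (d + 1)) (acc a (c a - (d + 1))) = acc a (c a - d) := by
        rw [hcd]
      let s₂ := s₁.setReg (b + 2) (s₁.reg (b + 3))
      let s₃ := s₂.setReg (b + 1) (s₂.reg (b + 1) + 1)
      have hr₁ : s₂.reg (b + 1) = c a - (d + 1) := by
        rw [setReg_ne _ _ (by omega), hr _ (by omega), h1]
      have hrlow : ∀ r < b, s₃.reg r = s.reg r := fun r h => by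
        rw [setReg_ne _ _ (by omega), setReg_ne _ _ (by omega), hr _ (by omega)]
      have harr : s₃.arr = s.arr := ha
      obtain ⟨t', s', he', hv', hr', ha', ht'⟩ := ih s₃ (by omega)
        (Ctx.frame hs hb hl hrlow fun c _ => by rw [harr])
        (by rw [setReg_ne _ _ (by omega), setReg_ne _ _ (by omega), hr _ (by omega), h0])
        (by rw [setReg_same, hr₁]; omega)
        (by rw [setReg_ne _ _ (by omega), setReg_same, hv, hacc'])
      refine ⟨_, s', .loop_true ?_ (.seq he (.seq (.assign _ _ _) (.assign _ _ _))) he', hv',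
        fun r h => (hr' r h).trans (hrlow r h), ha'.trans harr, ?_⟩
      · simp only [e, Exp.eval, h0, h1]; omega
      · have hM' : t ≤ M a := ht.trans (hThM a _ (by
          show Ctx.meas a + (c a - (d + 1)) + (acc a (c a - (d + 1))).size ≤ _
          have := hsz a (c a - (d + 1)) (by omega)
          change (acc a (c a - (d + 1))).size ≤ _ at this
          omega))
        have hG' : (s₁.reg (b + 3)).size ≤ G a := by
          rw [hv, hacc']; exact hsz a _ (by omega)
        have q1 := size_le_self (c a)
        have q2 := size_le_self (c a - (d + 1))
        have q3 := size_le_self (c a - (c a - (d + 1)))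
        have q4 := size_le_self (c a - (d + 1) + 1)
        have q5 := size_le_self 1
        simp only [e, Exp.cost, Exp.eval, h0, h1]
        change _ + (t + (_ + ((s₂.reg (b + 1)).size + 1 + _ +
          (s₂.reg (b + 1) + 1).size + 1 + 1))) + t' ≤ _
        rw [hr₁]
        have : (d + 1 + 1) * R a = (d + 1) * R a + R a := by ring
        rw [this]
        have hRa : R a = M a + 10 * c a + G a + 20 := rfl
        omega
  refine ⟨.seq pc (.seq pi (.seq (.assign (b + 1) (.lit 0)) (.seq (.loop e body)
    (.assign b (.var (b + 2)))))), fun a => Tc a + Ti a + (c a + 1) * R a + G a + 10,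
    (((hTc.add hTi).add ((hcb.add (.const 1)).mul hR)).add hG).add (.const 10), fun a s hs => ?_⟩
  obtain ⟨t₁, s₁, he₁, hv₁, hr₁, ha₁, ht₁⟩ := hpc a s hs
  have hs₁ : Holds l s₁ a := Ctx.frame hs hb hl hr₁ fun c _ => by rw [ha₁]
  obtain ⟨t₂, s₂, he₂, hv₂, hr₂, ha₂, ht₂⟩ := hpi a s₁ hs₁
  let s₃ := s₂.setReg (b + 1) 0
  have hrlow : ∀ r < b, s₃.reg r = s.reg r := fun r h => by
    rw [setReg_ne _ _ (by omega), hr₂ _ (by omega), hr₁ r h]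
  have harr : s₃.arr = s.arr := ha₂.trans ha₁
  obtain ⟨t₄, s₄, he₄, hv₄, hr₄, ha₄, ht₄⟩ := hloop a s₃ (c a) le_rfl
    (Ctx.frame hs hb hl hrlow fun c _ => by rw [harr])
    (by rw [setReg_ne _ _ (by omega), hr₂ _ (by omega), hv₁]) (by simp [s₃])
    (by rw [setReg_ne _ _ (by omega), hv₂]; simp [hacc])
  refine ⟨_, _, .seq he₁ (.seq he₂ (.seq (.assign _ _ _) (.seq he₄ (.assign _ _ _)))), ?_,
    fun r h => ?_, ha₄.trans harr, ?_⟩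
  · simp [Exp.eval, hv₄, hacc]
  · rw [setReg_ne _ _ (by omega), hr₄ r h, hrlow r h]
  · have := hsz a (c a) le_rfl
    change (acc a (c a)).size ≤ _ at this
    simp only [Exp.cost, hv₄, Nat.size_zero]
    omega

end PolyTime

/-- Uniform bound over the values of a small variable. -/
theorem PolyBdd.range {c : α → ℕ} {f : α → ℕ → ℕ} (hc : PolyBdd c)
    (hf : PolyBdd (fun p : α × ℕ => f p.1 p.2)) :
    ∃ M : α → ℕ, PolyBdd M ∧ ∀ a, ∀ i < c a, f a i ≤ M a := by
  obtain ⟨M, hM, h⟩ := hf.comp ((PolyBdd.meas (α := α)).add hc)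
  exact ⟨M, hM, fun a i hi => h a (a, i) (Nat.add_le_add_left hi.le _)⟩

namespace Small

theorem of_le {f g : α → ℕ} (hf : PolyTime f) (hg : PolyBdd g) (h : ∀ a, f a ≤ g a) : Small f :=
  ⟨hf, hg.mono h⟩

theorem const (c : ℕ) : Small (fun _ : α => c) := ⟨.const c, .const c⟩

theorem add {f g : α → ℕ} (hf : Small f) (hg : Small g) : Small (fun a => f a + g a) :=
  ⟨hf.1.add hg.1, hf.2.add hg.2⟩

theorem mul {f g : α → ℕ} (hf : Small f) (hg : Small g) : Small (fun a => f a * g a) :=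
  ⟨hf.1.mul hg.1, hf.2.mul hg.2⟩

theorem sub {f g : α → ℕ} (hf : Small f) (hg : PolyTime g) : Small (fun a => f a - g a) :=
  of_le (hf.1.sub hg) hf.2 fun _ => Nat.sub_le _ _

theorem snd : Small (fun a : α × ℕ => a.2) :=
  ⟨.snd, PolyBdd.meas.mono fun _ => Nat.le_add_left _ _⟩

theorem fst {f : α → ℕ} (hf : Small f) : Small (fun a : α × ℕ => f a.1) := ⟨hf.1.fst, hf.2.fst⟩

theorem fstWord {f : α → ℕ} (hf : Small f) : Small (fun a : α × Word => f a.1) :=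
  ⟨hf.1.fstWord, hf.2.fstWord⟩

end Small

/-! ### Bounded sums, products and maxima -/

namespace PolyTime

theorem mod {f g : α → ℕ} (hf : PolyTime f) (hg : PolyTime g) : PolyTime (fun a => f a % g a) :=
  (hf.sub (hg.mul (hf.div hg))).congr fun a => by
    have := Nat.mod_add_div (f a) (g a)
    omega

theorem min {f g : α → ℕ} (hf : PolyTime f) (hg : PolyTime g) :
    PolyTime (fun a => Min.min (f a) (g a)) :=
  (hf.sub (hf.sub hg)).congr fun a => by omega

theorem max {f g : α → ℕ} (hf : PolyTime f) (hg : PolyTime g) :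
    PolyTime (fun a => Max.max (f a) (g a)) :=
  (hf.add (hg.sub hf)).congr fun a => by omega

theorem sum {c : α → ℕ} {f : α → ℕ → ℕ} (hc : Small c)
    (hf : PolyTime (fun p : α × ℕ => f p.1 p.2)) :
    PolyTime (fun a => ∑ i ∈ Finset.range (c a), f a i) := by
  obtain ⟨M, hM, h⟩ := PolyBdd.range (f := fun a i => (f a i).size) hc.2 hf.1
  have hrec : ∀ a j, (Nat.rec 0 (fun i acc => acc + f a i) j : ℕ) =
      ∑ i ∈ Finset.range j, f a i := by
    intro a j
    induction j with
    | zero => simp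
    | succ j ih => rw [Finset.sum_range_succ, ← ih]
  refine (iter (init := fun _ => 0) (h := fun a i acc => acc + f a i) hc (.const 0)
    (word.add hf.fstWord) (hc.2.add (hM.add (.const 1))) fun a j hj => ?_).congr fun a => hrec a _
  rw [hrec]
  have : ∑ i ∈ Finset.range j, f a i ≤ c a * 2 ^ M a := by
    refine (Finset.sum_le_card_nsmul _ _ (2 ^ M a) fun i hi => ?_).trans ?_
    · rw [Finset.mem_range] at hi
      exact (Nat.size_le.1 (h a i (by omega))).le
    · rw [Finset.card_range, smul_eq_mul]
      exact Nat.mul_le_mul_right _ hj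
  refine (Nat.size_le_size this).trans ((size_mul_le _ _).trans ?_)
  rw [Nat.size_pow]
  have := size_le_self (c a)
  omega

theorem prod {c : α → ℕ} {f : α → ℕ → ℕ} (hc : Small c)
    (hf : PolyTime (fun p : α × ℕ => f p.1 p.2)) :
    PolyTime (fun a => ∏ i ∈ Finset.range (c a), f a i) := by
  obtain ⟨M, hM, h⟩ := PolyBdd.range (f := fun a i => (f a i).size) hc.2 hf.1
  have hrec : ∀ a j, (Nat.rec 1 (fun i acc => acc * f a i) j : ℕ) =
      ∏ i ∈ Finset.range j, f a i := by
    intro a j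
    induction j with
    | zero => simp
    | succ j ih => rw [Finset.prod_range_succ, ← ih]
  refine (iter (init := fun _ => 1) (h := fun a i acc => acc * f a i) hc (.const 1)
    (word.mul hf.fstWord) ((hM.mul hc.2).add (.const 1)) fun a j hj => ?_).congr fun a => hrec a _
  rw [hrec]
  have : ∏ i ∈ Finset.range j, f a i ≤ 2 ^ (M a * c a) := by
    calc ∏ i ∈ Finset.range j, f a i ≤ ∏ i ∈ Finset.range j, 2 ^ M a := by
          refine Finset.prod_le_prod' fun i hi => ?_
          rw [Finset.mem_range] at hi
          exact (Nat.size_le.1 (h a i (by omega))).le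
      _ = 2 ^ (M a * j) := by simp [pow_mul]
      _ ≤ _ := Nat.pow_le_pow_right (by omega) (Nat.mul_le_mul_left _ hj)
  refine (Nat.size_le_size this).trans ?_
  rw [Nat.size_pow]

theorem sup {c : α → ℕ} {f : α → ℕ → ℕ} (hc : Small c)
    (hf : PolyTime (fun p : α × ℕ => f p.1 p.2)) :
    PolyTime (fun a => (Finset.range (c a)).sup (f a)) := by
  obtain ⟨M, hM, h⟩ := PolyBdd.range (f := fun a i => (f a i).size) hc.2 hf.1
  have hrec : ∀ a j, (Nat.rec 0 (fun i acc => Max.max (f a i) acc) j : ℕ) =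
      (Finset.range j).sup (f a) := by
    intro a j
    induction j with
    | zero => simp
    | succ j ih => rw [Finset.range_add_one, Finset.sup_insert, ← ih]
  refine (iter (init := fun _ => 0) (h := fun a i acc => Max.max (f a i) acc) hc (.const 0)
    (hf.fstWord.max word) (hM.add (.const 1)) fun a j hj => ?_).congr fun a => hrec a _
  rw [hrec]
  have : (Finset.range j).sup (f a) ≤ 2 ^ M a := by
    refine Finset.sup_le fun i hi => ?_
    rw [Finset.mem_range] at hi
    exact (Nat.size_le.1 (h a i (by omega))).le
  refine (Nat.size_le_size this).trans ?_
  rw [Nat.size_pow]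

theorem pow {f e : α → ℕ} (hf : PolyTime f) (he : Small e) : PolyTime (fun a => f a ^ e a) :=
  (prod (f := fun a _ => f a) he hf.fst).congr fun a => by simp

end PolyTime

theorem Small.sum {c : α → ℕ} {f : α → ℕ → ℕ} (hc : Small c)
    (hf : Small (fun p : α × ℕ => f p.1 p.2)) :
    Small (fun a => ∑ i ∈ Finset.range (c a), f a i) := by
  obtain ⟨M, hM, h⟩ := hc.2.range hf.2
  refine .of_le (.sum hc hf.1) (hc.2.mul hM) fun a => ?_
  refine (Finset.sum_le_card_nsmul _ _ (M a) fun i hi => h a i (Finset.mem_range.1 hi)).trans ?_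
  simp

/-! ### Polynomial-time predicates -/

open Classical in
/-- Predicates that are decided in polynomial time. -/
def PolyDec (P : α → Prop) : Prop := PolyTime (fun a => if P a then 1 else 0)

/-- Both branches are evaluated and combined as `P * f + (1 - P) * g`; this is harmless because all
functions are total. -/
theorem PolyTime.ite {P : α → Prop} {_ : DecidablePred P} {f g : α → ℕ} (hP : PolyDec P)
    (hf : PolyTime f) (hg : PolyTime g) : PolyTime (fun a => if P a then f a else g a) := by
  have hP' : PolyTime (fun a => if P a then 1 else 0) := by
    refine hP.congr fun a => ?_
    split_ifs <;> rfl
  refine ((hP'.mul hf).add (((PolyTime.const 1).sub hP').mul hg)).congr fun a => ?_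
  split_ifs <;> simp

theorem Small.ite {P : α → Prop} {_ : DecidablePred P} {f g : α → ℕ} (hP : PolyDec P)
    (hf : Small f) (hg : Small g) : Small (fun a => if P a then f a else g a) :=
  .of_le (.ite hP hf.1 hg.1) (hf.2.add hg.2) fun a => by split_ifs <;> omega

namespace PolyDec

theorem congr {P R : α → Prop} (hP : PolyDec P) (h : ∀ a, P a ↔ R a) : PolyDec R :=
  (funext fun a => propext (h a) : P = R) ▸ hP

theorem le {f g : α → ℕ} (hf : PolyTime f) (hg : PolyTime g) : PolyDec (fun a => f a ≤ g a) :=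
  ((PolyTime.const 1).sub (hf.sub hg)).congr fun a => by split_ifs <;> omega

theorem lt {f g : α → ℕ} (hf : PolyTime f) (hg : PolyTime g) : PolyDec (fun a => f a < g a) :=
  le (hf.add (.const 1)) hg

theorem and {P R : α → Prop} (hP : PolyDec P) (hR : PolyDec R) : PolyDec (fun a => P a ∧ R a) :=
  (PolyTime.mul hP hR).congr fun a => by by_cases h1 : P a <;> by_cases h2 : R a <;> simp [h1, h2]

theorem not {P : α → Prop} (hP : PolyDec P) : PolyDec (fun a => ¬ P a) :=
  ((PolyTime.const 1).sub hP).congr fun a => by by_cases h1 : P a <;> simp [h1]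

theorem imp {P R : α → Prop} (hP : PolyDec P) (hR : PolyDec R) : PolyDec (fun a => P a → R a) :=
  (hP.and hR.not).not.congr fun a => by tauto

theorem eq {f g : α → ℕ} (hf : PolyTime f) (hg : PolyTime g) : PolyDec (fun a => f a = g a) :=
  ((le hf hg).and (le hg hf)).congr fun _ => le_antisymm_iff.symm

theorem ball {c : α → ℕ} {P : α → ℕ → Prop} (hc : Small c)
    (hP : PolyDec (fun p : α × ℕ => P p.1 p.2)) : PolyDec (fun a => ∀ i < c a, P a i) := by
  classical
  exact (PolyTime.prod (f := fun a i => if P a i then 1 else 0) hc hP).congr fun a => by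
    rw [Finset.prod_ite_zero]
    simp

theorem bex {c : α → ℕ} {P : α → ℕ → Prop} (hc : Small c)
    (hP : PolyDec (fun p : α × ℕ => P p.1 p.2)) : PolyDec (fun a => ∃ i < c a, P a i) :=
  (ball (P := fun a i => ¬ P a i) hc hP.not).not.congr fun a => by
    push Not
    rfl

end PolyDec

/-! ### Course-of-values recursion -/

/-- Digit number `u` of `X` in base `B`. -/
def digit (B X u : ℕ) : ℕ := X / B ^ u % B

/-- The function defined by course-of-values recursion: `g t r` is its value at `t`, where `r` holds
the values below `t`, and zeros from there on. -/
def recTable (g : ℕ → (ℕ → ℕ) → ℕ) (t : ℕ) : ℕ :=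
  g t fun u => if u < t then recTable g u else 0
termination_by t

/-- The first `t` values of a function defined by course-of-values recursion, as the digits of a
number in base `B`. -/
def recCode (B : ℕ) (g : ℕ → (ℕ → ℕ) → ℕ) : ℕ → ℕ :=
  Nat.rec 0 fun t X => X + g t (digit B X) * B ^ t

/-- All values before `t` are at most `t * Y` by induction, and the step adds at most `Y`. Growth is
thus linear in the number of steps, and bit lengths stay polynomial. -/
theorem recTable_le {g : ℕ → (ℕ → ℕ) → ℕ} {c Y : ℕ}
    (hg : ∀ t r M, t < c → (∀ u, r u ≤ M) → g t r ≤ M + Y) (t : ℕ) (ht : t < c) :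
    recTable g t ≤ (t + 1) * Y := by
  induction t using Nat.strong_induction_on with
  | _ t ih =>
    rw [recTable, add_mul, one_mul]
    refine hg t _ _ ht fun u => ?_
    split_ifs with h
    · exact (ih u h (h.trans ht)).trans (Nat.mul_le_mul_right _ h)
    · exact Nat.zero_le _

/-- Adding a digit smaller than `B` at place `t` to a number below `B ^ t` causes no carry and
leaves the lower digits alone; the digits not yet written are zero, which is the convention of
`recTable`. -/
theorem recCode_spec {g : ℕ → (ℕ → ℕ) → ℕ} {c B : ℕ}
    (hB : ∀ t < c, recTable g t < B) (t : ℕ) (ht : t ≤ c) :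
    recCode B g t < B ^ t ∧
      digit B (recCode B g t) = fun u => if u < t then recTable g u else 0 := by
  induction t with
  | zero => exact ⟨by simp [recCode], by funext u; simp [recCode, digit]⟩
  | succ t ih =>
    obtain ⟨h1, h2⟩ := ih (by omega)
    have hBt := hB t ht
    have hpos : 0 < B := by omega
    have hX : recCode B g (t + 1) = recCode B g t + recTable g t * B ^ t := by
      rw [recTable, ← h2]; rfl
    have hlt : recCode B g (t + 1) < B ^ (t + 1) := by
      rw [hX, pow_succ]
      have : (recTable g t + 1) * B ^ t ≤ B * B ^ t := Nat.mul_le_mul_right _ hBt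
      nlinarith
    refine ⟨hlt, funext fun u => ?_⟩
    rcases lt_trichotomy u t with h | rfl | h
    · rw [if_pos (by omega)]
      have h3 := congrFun h2 u
      rw [if_pos h] at h3
      rw [← h3, digit, digit, hX]
      obtain ⟨d, rfl⟩ := Nat.exists_eq_add_of_lt h
      have : recTable g (u + d + 1) * B ^ (u + d + 1) =
          (recTable g (u + d + 1) * B ^ d * B) * B ^ u := by ring
      rw [this, Nat.add_mul_div_right _ _ (Nat.pow_pos hpos), Nat.add_mul_mod_self_right]
    · rw [if_pos (by omega), digit, hX, Nat.add_mul_div_right _ _ (Nat.pow_pos hpos),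
        Nat.div_eq_of_lt h1, zero_add, Nat.mod_eq_of_lt hBt]
    · rw [if_neg (by omega), digit, Nat.div_eq_of_lt, Nat.zero_mod]
      exact hlt.trans_le (Nat.pow_le_pow_right hpos (by omega))

theorem PolyTime.digit {B X u : α → ℕ} (hB : PolyTime B) (hX : PolyTime X) (hu : Small u) :
    PolyTime (fun a => RAM.digit (B a) (X a) (u a)) :=
  (hX.div (hB.pow hu)).mod hB

/-- Course-of-values recursion whose values grow at most by `Y` in each step. -/
theorem PolyTime.recTable {c Y u : α → ℕ} {g : α → ℕ → (ℕ → ℕ) → ℕ} (hc : Small c)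
    (hY : PolyTime Y) (hu : PolyTime u) (huc : ∀ a, u a < c a)
    (hg : ∀ B : α → ℕ, PolyTime B →
      PolyTime (fun p : (α × ℕ) × Word => g p.1.1 p.1.2 (RAM.digit (B p.1.1) p.2.val)))
    (hgrow : ∀ a t r M, t < c a → (∀ u, r u ≤ M) → g a t r ≤ M + Y a) :
    PolyTime (fun a => RAM.recTable (g a) (u a)) := by
  -- By `recTable_le` the values below `c a` are at most `c a * Y a`, hence digits in this base.
  let B : α → ℕ := fun a => c a * Y a + 1
  have hB : PolyTime B := (hc.1.mul hY).add (.const 1)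
  have hlt : ∀ a, ∀ t < c a, RAM.recTable (g a) t < B a := fun a t ht =>
    Nat.lt_succ_of_le ((recTable_le (hgrow a) t ht).trans (Nat.mul_le_mul_right _ ht))
  have hcode : PolyTime (fun a => recCode (B a) (g a) (c a)) := by
    refine iter (init := fun _ => 0)
      (h := fun a t X => X + g a t (RAM.digit (B a) X) * B a ^ t) hc (.const 0)
      (word.add ((hg B hB).mul ((hB.fst.pow .snd).fstWord))) (hB.pow hc).1 fun a i hi => ?_
    refine Nat.size_le_size ?_
    exact ((recCode_spec (hlt a) i hi).1.le).trans (Nat.pow_le_pow_right (Nat.succ_pos _) hi)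
  refine (PolyTime.digit hB hcode ⟨hu, hc.2.mono fun a => (huc a).le⟩).congr fun a => ?_
  rw [(recCode_spec (hlt a) (c a) le_rfl).2]
  exact if_pos (huc a)

/-! ### Reading the input -/

theorem Small.agents : Small (fun a : α => (query a).inst.n) := by
  have hb : PolyBdd (fun a : α => (query a).inst.n) := by
    refine PolyBdd.meas.mono fun a => ?_
    refine le_trans ?_ ((Nat.le_add_right _ _).trans (size_le a))
    -- A denominator has at least one bit, so the instance length bounds the number of agents itself
    -- and not just its bit length.
    have : ∑ i : Fin (query a).inst.n, 1 ≤ ∑ i : Fin (query a).inst.n,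
        (SingleMinded.bits ((query a).inst.z i) + SingleMinded.bits ((query a).inst.b i)) := by
      refine Finset.sum_le_sum fun i _ => ?_
      have : 0 < ((query a).inst.z i).den.size := Nat.size_pos.2 (NNRat.den_pos _)
      simp only [SingleMinded.bits]; omega
    simp only [Finset.sum_const, Finset.card_univ, Fintype.card_fin, smul_eq_mul, mul_one] at this
    simp only [SingleMinded.size]; omega
  refine ⟨.of_exp (hb.mono fun a => size_le_self _) fun l b _ _ => ⟨.var 0, _, hb.add (.const 1),
    fun a s hs => ?_⟩, hb⟩
  have : s.reg 0 = (query a).inst.n := (reads hs).1 0 (by omega)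
  exact ⟨this, by simpa [Exp.cost, this] using size_le_self _⟩

theorem Small.projects : Small (fun a : α => (query a).inst.m) := by
  have hb : PolyBdd (fun a : α => (query a).inst.m) := by
    refine PolyBdd.meas.mono fun a => ?_
    refine le_trans ?_ ((Nat.le_add_right _ _).trans (size_le a))
    have : ∑ j : Fin (query a).inst.m, 1 ≤ ∑ j : Fin (query a).inst.m,
        SingleMinded.bits ((query a).inst.C j) := by
      refine Finset.sum_le_sum fun i _ => ?_
      have : 0 < ((query a).inst.C i).den.size := Nat.size_pos.2 (NNRat.den_pos _)
      simp only [SingleMinded.bits]; omega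
    simp only [Finset.sum_const, Finset.card_univ, Fintype.card_fin, smul_eq_mul, mul_one] at this
    simp only [SingleMinded.size]; omega
  refine ⟨.of_exp (hb.mono fun a => size_le_self _) fun l b _ _ => ⟨.var 1, _, hb.add (.const 1),
    fun a s hs => ?_⟩, hb⟩
  have : s.reg 1 = (query a).inst.m := (reads hs).1 1 (by omega)
  exact ⟨this, by simpa [Exp.cost, this] using size_le_self _⟩

theorem Small.accuracy : Small (fun a : α => (query a).acc) := by
  have hb : PolyBdd (fun a : α => (query a).acc) :=
    PolyBdd.meas.mono fun a => (Nat.le_add_left _ _).trans (size_le a)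
  refine ⟨.of_exp (hb.mono fun a => size_le_self _) fun l b _ _ => ⟨.var 2, _, hb.add (.const 1),
    fun a s hs => ?_⟩, hb⟩
  have : s.reg 2 = (query a).acc := (reads hs).1 2 (by omega)
  exact ⟨this, by simpa [Exp.cost, this] using size_le_self _⟩

theorem size_ofFin_le {n : ℕ} (f : Fin n → ℕ) (k M : ℕ) (h : ∀ i, (f i).size ≤ M) :
    (ofFin f k).size ≤ M := by
  unfold ofFin
  split_ifs
  · exact h _
  · simp

theorem size_input_le (I : SingleMinded) (k c j : ℕ) (hc : c < 7) :
    ((I.input k).arr c j).size ≤ I.size + 1 := by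
  have hn : ∀ i, SingleMinded.bits (I.z i) + SingleMinded.bits (I.b i) ≤ I.size := fun i => by
    have := Finset.single_le_sum
      (f := fun i => SingleMinded.bits (I.z i) + SingleMinded.bits (I.b i))
      (fun _ _ => Nat.zero_le _) (Finset.mem_univ i)
    simp only [SingleMinded.size]; omega
  have hm : ∀ j, SingleMinded.bits (I.C j) ≤ I.size := fun i => by
    have := Finset.single_le_sum (f := fun i => SingleMinded.bits (I.C i))
      (fun _ _ => Nat.zero_le _) (Finset.mem_univ i)
    simp only [SingleMinded.size]; omega
  simp only [SingleMinded.bits] at hn hm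
  match c, hc with
  | 0, _ => exact size_ofFin_le (fun i => (I.z i).num) j _ fun i => by have := hn i; omega
  | 1, _ => exact size_ofFin_le (fun i => (I.z i).den) j _ fun i => by have := hn i; omega
  | 2, _ => exact size_ofFin_le (fun i => (I.b i).num) j _ fun i => by have := hn i; omega
  | 3, _ => exact size_ofFin_le (fun i => (I.b i).den) j _ fun i => by have := hn i; omega
  | 4, _ => exact size_ofFin_le (fun i => (I.C i).num) j _ fun i => by have := hm i; omega
  | 5, _ => exact size_ofFin_le (fun i => (I.C i).den) j _ fun i => by have := hm i; omega
  | 6, _ =>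
    refine le_trans (Nat.size_le.2 ?_) (Nat.le_add_left 1 _)
    simp only [SingleMinded.input]
    split_ifs <;> simp

theorem PolyTime.input {f : α → ℕ} (c : ℕ) (hc : c < 7) (hf : PolyTime f) :
    PolyTime (fun a => ((query a).inst.input (query a).acc).arr c (f a)) := by
  have hb : PolyBdd (fun a => (((query a).inst.input (query a).acc).arr c (f a)).size) :=
    (PolyBdd.meas.add (.const 1)).mono fun a => (size_input_le _ _ _ _ hc).trans
      (Nat.add_le_add_right ((Nat.le_add_right _ _).trans (size_le a)) 1)
  refine hf.unop hb (.get c) _ (hb.add (.const 1)) fun l s a e hs he => ?_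
  simp only [Exp.eval, Exp.cost, he, (reads hs).2 c hc]
  exact ⟨trivial, by omega⟩

/-! ### Writing the output -/

/-- An array other than the input arrays can be filled with the values of a function. -/
theorem PolyTime.fill {c : Query → ℕ} {f : Query → ℕ → ℕ} (hc : Small c)
    (hf : PolyTime (fun p : Query × ℕ => f p.1 p.2)) (A : ℕ) (hA : 7 ≤ A) :
    ∃ p T, PolyBdd T ∧ ∀ q s, Holds [] s q → ∃ t s', Exec p s t s' ∧ Holds [] s' q ∧
      (∀ i < c q, s'.arr A i = f q i) ∧ (∀ A', A' ≠ A → s'.arr A' = s.arr A') ∧ t ≤ T q := by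
  -- Register 3 holds the number of cells, register 4 the counter, which is also the variable in the
  -- context of `f`, and register 5 the value to be stored.
  obtain ⟨pc, Tc, hTc, hpc⟩ := hc.1.2 [] 3 le_rfl (by simp)
  obtain ⟨pf, Tf, hTf, hpf⟩ := hf.2 [4] 5 (by omega) (by simp)
  obtain ⟨M, hM, hTM⟩ := PolyBdd.range (f := fun q i => Tf (q, i)) hc.2 hTf
  obtain ⟨G, hG, hfG⟩ := PolyBdd.range (f := fun q i => (f q i).size) hc.2 hf.1
  let e : Exp := .sub (.var 3) (.var 4)
  let body : Cmd := .seq pf (.seq (.put A (.var 4) (.var 5)) (.assign 4 (.add (.var 4) (.lit 1))))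
  let R : Query → ℕ := fun q => M q + 10 * c q + G q + 20
  have hR : PolyBdd R := ((hM.add ((PolyBdd.const 10).mul hc.2)).add hG).add (.const 20)
  have hloop : ∀ q s d, d ≤ c q → Holds [] s q → s.reg 3 = c q → s.reg 4 = c q - d →
      (∀ i < c q - d, s.arr A i = f q i) →
      ∃ t s', Exec (.loop e body) s t s' ∧ Holds [] s' q ∧
      (∀ i < c q, s'.arr A i = f q i) ∧ (∀ A', A' ≠ A → s'.arr A' = s.arr A') ∧
        t ≤ (d + 1) * R q := by
    intro q s d
    induction d generalizing s with
    | zero =>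
      intro _ hs h3 h4 hv
      have hs1 := size_le_self (c q)
      refine ⟨_, s, .loop_false (by simp [e, Exp.eval, h3, h4]), hs, by simpa using hv,
        fun _ _ => rfl, ?_⟩
      simp only [e, Exp.cost, Exp.eval, h3, h4, R]
      simp only [Nat.sub_zero, Nat.sub_self, Nat.size_zero]
      omega
    | succ d ih =>
      intro hd hs h3 h4 hv
      obtain ⟨t, s₁, he, hv₁, hr, ha, ht⟩ := hpf (q, c q - (d + 1)) s ⟨_, _, rfl, h4, hs⟩
      let s₂ := s₁.setArr A (s₁.reg 4) (s₁.reg 5)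
      let s₃ := s₂.setReg 4 (s₂.reg 4 + 1)
      have h4' : s₁.reg 4 = c q - (d + 1) := (hr 4 (by omega)).trans h4
      have harr : ∀ A', A' ≠ A → s₃.arr A' = s.arr A' := fun A' hA' => by
        rw [← ha]; simp [s₃, s₂, Store.setReg, Store.setArr, hA']
      have hH : Holds [] s₃ q := by
        refine Ctx.frame hs (b := 3) le_rfl (by simp) (fun r h => ?_) fun c h => harr c (by omega)
        rw [setReg_ne _ _ (by omega)]
        exact hr r (by omega)
      have hcell : ∀ i, s₃.arr A i = if i = c q - (d + 1) then f q i else s.arr A i := by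
        intro i
        simp only [s₃, s₂, Store.setReg, Store.setArr, h4', hv₁, ha, Function.update_self]
        by_cases hi : i = c q - (d + 1)
        · subst hi; simp
        · simp [hi]
      obtain ⟨t', s', he', hH', hv', ha', ht'⟩ := ih s₃ (by omega) hH
        ((setReg_ne _ _ (by omega)).trans ((hr 3 (by omega)).trans h3))
        (by simp only [s₃, s₂, setReg_same, setArr_reg, h4']; omega) (by
          intro i hi
          rw [hcell]
          split_ifs with h
          · rfl
          · exact hv i (by omega))
      refine ⟨_, s', .loop_true ?_ (.seq he (.seq (.put _ _ _ _) (.assign _ _ _))) he', hH', hv',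
        fun A' hA' => (ha' A' hA').trans (harr A' hA'), ?_⟩
      · simp only [e, Exp.eval, h3, h4]; omega
      · have hM' := hTM q (c q - (d + 1)) (by omega)
        have hG' := hfG q (c q - (d + 1)) (by omega)
        have q1 := size_le_self (c q)
        have q2 := size_le_self (c q - (d + 1))
        have q3 := size_le_self (c q - (c q - (d + 1)))
        have q4 := size_le_self (c q - (d + 1) + 1)
        have q5 := size_le_self 1
        simp only [e, Exp.cost, Exp.eval, h3, h4, hv₁, setArr_reg, h4']
        have : (d + 1 + 1) * R q = (d + 1) * R q + R q := by ring
        rw [this]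
        have hRa : R q = M q + 10 * c q + G q + 20 := rfl
        omega
  refine ⟨.seq pc (.seq (.assign 4 (.lit 0)) (.loop e body)),
    fun q => Tc q + (c q + 1) * R q + 10,
    (hTc.add ((hc.2.add (.const 1)).mul hR)).add (.const 10), fun q s hs => ?_⟩
  obtain ⟨t, s₁, he, hv, hr, ha, ht⟩ := hpc q s hs
  have hs₁ : Holds [] (s₁.setReg 4 0) q := by
    refine Ctx.frame hs (b := 3) le_rfl (by simp) (fun r h => ?_) fun c _ => by rw [setReg_arr, ha]
    rw [setReg_ne _ _ (by omega)]
    exact hr r h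
  obtain ⟨t', s', he', hH', hv', ha', ht'⟩ := hloop q (s₁.setReg 4 0) (c q) le_rfl hs₁
    ((setReg_ne _ _ (by omega)).trans hv) (by simp) (by simp)
  refine ⟨_, s', .seq he (.seq (.assign _ _ _) he'), hH', hv',
    fun A' hA' => (ha' A' hA').trans (by rw [setReg_arr, ha]), ?_⟩
  show _ ≤ Tc q + (c q + 1) * R q + 10
  simp only [Exp.cost, Nat.size_zero]
  omega

end RAM

/-!
## The algorithm

The numbers are scaled to integers. The demand sets of a laminar family are intervals in a suitable
order of the projects, and a dynamic program over the prefixes of that order finds, for every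
rounded welfare, a family of disjoint demand sets with the largest budget surplus.
-/

open Finset

/-- An instance with integer data. -/
structure Scaled where
  /-- number of agents -/
  n : ℕ
  /-- number of projects -/
  m : ℕ
  /-- accuracy -/
  k : ℕ
  /-- agent `i` demands project `j` if `d i j = 1` -/
  d : ℕ → ℕ → ℕ
  /-- values -/
  Z : ℕ → ℕ
  /-- largest acceptable payments: budgets truncated at the values -/
  β : ℕ → ℕ
  /-- costs -/
  C : ℕ → ℕ

namespace Scaled

open Classical

variable (P : Scaled)

/-- Size of the demand set of agent `i`. -/
noncomputable def card (i : ℕ) : ℕ := ∑ j ∈ range P.m, if P.d i j = 1 then 1 else 0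

/-- Position of agent `i` when the agents are sorted by the sizes of their demand sets. -/
noncomputable def pos (i : ℕ) : ℕ := P.card i * P.n + i

/-- The sort key of project `j`: its membership in the demand sets, the largest sets first. -/
noncomputable def sig (j : ℕ) : ℕ := ∑ i ∈ range P.n, if P.d i j = 1 then 2 ^ P.pos i else 0

/-- Number of projects before the demand set of agent `i`. -/
noncomputable def lo (i : ℕ) : ℕ :=
  ∑ j ∈ range P.m, if ∀ j' < P.m, P.d i j' = 1 → P.sig j < P.sig j' then 1 else 0

/-- Number of projects up to the end of the demand set of agent `i`. -/
noncomputable def hi (i : ℕ) : ℕ :=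
  ∑ j ∈ range P.m, if ∃ j' < P.m, P.d i j' = 1 ∧ P.sig j ≤ P.sig j' then 1 else 0

/-- The demand set of agent `a` is nonempty and contained in that of agent `i`. -/
def Below (a i : ℕ) : Prop := (∀ j < P.m, P.d a j = 1 → P.d i j = 1) ∧ 0 < P.card a

/-- Value that the demand set of agent `i` generates. -/
noncomputable def val (i : ℕ) : ℕ := ∑ a ∈ range P.n, if P.Below a i then P.Z a else 0

/-- Budget that the demand set of agent `i` releases. -/
noncomputable def bud (i : ℕ) : ℕ := ∑ a ∈ range P.n, if P.Below a i then P.β a else 0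

/-- Cost of the demand set of agent `i`. -/
noncomputable def cst (i : ℕ) : ℕ := ∑ j ∈ range P.m, if P.d i j = 1 then P.C j else 0

/-- The demand set of agent `i` as a bit mask. -/
noncomputable def mask (i : ℕ) : ℕ := ∑ j ∈ range P.m, if P.d i j = 1 then 2 ^ j else 0

/-- Welfare that the demand set of agent `i` generates. -/
noncomputable def gain (i : ℕ) : ℕ := P.val i - P.cst i

/-- A number above the total cost. -/
noncomputable def offset : ℕ := ∑ j ∈ range P.m, P.C j + 1

/-- Rounded welfare, when agent `g` has the largest welfare. -/
noncomputable def wt (g i : ℕ) : ℕ := P.gain i * P.n * P.k / P.gain g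

/-- Number of columns of the table. -/
def cols : ℕ := P.n * P.n * P.k + 1

/-- The demand sets that are considered when agent `g` has the largest welfare. -/
def Adm (g i : ℕ) : Prop := P.cst i < P.val i ∧ P.gain i ≤ P.gain g

/-- The entry number `t` of the table, given the entries `r` before. -/
noncomputable def entry (g t : ℕ) (r : ℕ → ℕ) : ℕ :=
  if t < P.cols then (if t = 0 then P.offset * 2 ^ P.m else 0) else
    max (r (t - P.cols)) ((range P.n).sup fun i =>
      if P.hi i = t / P.cols ∧ P.Adm g i ∧ P.wt g i ≤ t % P.cols ∧
          r (P.lo i * P.cols + (t % P.cols - P.wt g i)) ≠ 0 then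
        r (P.lo i * P.cols + (t % P.cols - P.wt g i)) + (P.bud i * 2 ^ P.m + P.mask i)
          - P.cst i * 2 ^ P.m
      else 0)

/-- The table. Row `p` is for demand sets among the first `p` projects, column `q` for families of
rounded welfare `q`. An entry holds the surplus, increased by `offset`, and the bit mask of the
union; it is zero if there is no family. -/
noncomputable def cell (g p q : ℕ) : ℕ := RAM.recTable (P.entry g) (p * P.cols + q)

/-- The bit mask `w` contains the demand set of agent `i`. -/
def Sat (i w : ℕ) : Prop := ∀ j < P.m, P.d i j = 1 → w / 2 ^ j % 2 = 1

/-- Value of a bit mask. -/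
noncomputable def maskVal (w : ℕ) : ℕ := ∑ a ∈ range P.n, if P.Sat a w then P.Z a else 0

/-- Budget released by a bit mask. -/
noncomputable def maskBud (w : ℕ) : ℕ := ∑ a ∈ range P.n, if P.Sat a w then P.β a else 0

/-- Cost of a bit mask. -/
noncomputable def maskCst (w : ℕ) : ℕ := ∑ j ∈ range P.m, if w / 2 ^ j % 2 = 1 then P.C j else 0

/-- A bit mask with its welfare, if it is affordable. -/
noncomputable def cand (w : ℕ) : ℕ :=
  if P.maskCst w ≤ P.maskBud w then (P.maskVal w - P.maskCst w) * 2 ^ P.m + w else 0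

/-- The best bit mask, with its welfare. -/
noncomputable def best : ℕ := max (P.maskVal 0 * 2 ^ P.m)
  ((range P.n).sup fun g => (range P.cols).sup fun q => P.cand (P.cell g P.m q % 2 ^ P.m))

/-- The bit mask of the projects to be funded. -/
noncomputable def out : ℕ := P.best % 2 ^ P.m

/-- The payment of agent `i`. -/
noncomputable def pay (i : ℕ) : ℕ :=
  if P.Sat i P.out then
    min (P.β i) (P.maskCst P.out - ∑ a ∈ range i, if P.Sat a P.out then P.β a else 0)
  else 0

/-! ### Demand sets -/

/-- The demand set of agent `i`. -/
def D (i : ℕ) : Finset ℕ := {j ∈ range P.m | P.d i j = 1}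

/-- The demand sets form a laminar family. -/
def IsLaminar : Prop := ∀ i < P.n, ∀ i' < P.n,
  P.D i ∩ P.D i' = ∅ ∨ P.D i ∩ P.D i' = P.D i ∨ P.D i ∩ P.D i' = P.D i'

variable {P}

theorem mem_D {i j : ℕ} : j ∈ P.D i ↔ j < P.m ∧ P.d i j = 1 := by simp [D]

theorem card_eq (i : ℕ) : P.card i = #(P.D i) := by
  rw [card, sum_ite, sum_const_zero, add_zero, D, card_eq_sum_ones]

theorem cst_eq (i : ℕ) : P.cst i = ∑ j ∈ P.D i, P.C j := by rw [cst, D, sum_filter]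

theorem mask_eq (i : ℕ) : P.mask i = ∑ j ∈ P.D i, 2 ^ j := by rw [mask, D, sum_filter]

theorem below_iff {a i : ℕ} : P.Below a i ↔ P.D a ⊆ P.D i ∧ (P.D a).Nonempty := by
  rw [Below, card_eq, card_pos]
  refine and_congr_left fun _ => ⟨fun h j hj => ?_, fun h j hj h1 => ?_⟩
  · rw [mem_D] at hj ⊢
    exact ⟨hj.1, h j hj.1 hj.2⟩
  · exact (mem_D.1 (h (mem_D.2 ⟨hj, h1⟩))).2

/-! ### The sort key separates disjoint demand sets -/

theorem sig_eq (j : ℕ) : P.sig j = ∑ i ∈ range P.n with P.d i j = 1, 2 ^ P.pos i := by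
  rw [sig, sum_filter]

/-- The index is a last digit in base `n` that only breaks ties; `a < n` ensures that it does not
spill over into the cardinality. -/
theorem pos_le {i a : ℕ} (ha : a < P.n) (h : P.pos i ≤ P.pos a) :
    #(P.D i) ≤ #(P.D a) := by
  rw [← card_eq, ← card_eq]
  simp only [pos] at h
  by_contra hc
  have : (P.card a + 1) * P.n ≤ P.card i * P.n := Nat.mul_le_mul_right _ (by omega)
  rw [add_mul] at this
  omega

theorem pos_inj {i a : ℕ} (hi : i < P.n) (ha : a < P.n) (h : P.pos i = P.pos a) : i = a := by
  have h1 := le_antisymm (pos_le ha h.le) (pos_le hi h.ge)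
  rw [← card_eq, ← card_eq] at h1
  simp only [pos, h1] at h
  omega

/-- The distinct powers below `2 ^ c` add up to less than `2 ^ c`, and the others are divisible by
it. -/
theorem sum_two_pow_div (E : Finset ℕ) (c : ℕ) :
    (∑ e ∈ E, 2 ^ e) / 2 ^ c = ∑ e ∈ E with c ≤ e, 2 ^ (e - c) := by
  have h1 : ∑ e ∈ E, 2 ^ e =
      ∑ e ∈ E with ¬ c ≤ e, 2 ^ e + (∑ e ∈ E with c ≤ e, 2 ^ (e - c)) * 2 ^ c := by
    rw [sum_mul, ← sum_filter_add_sum_filter_not E (fun e => c ≤ e) (fun e => 2 ^ e), add_comm]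
    congr 1
    refine sum_congr rfl fun e he => ?_
    rw [← pow_add, Nat.sub_add_cancel (mem_filter.1 he).2]
  have h2 : ∑ e ∈ E with ¬ c ≤ e, 2 ^ e < 2 ^ c :=
    Nat.geomSum_lt le_rfl fun e he => by simpa using (mem_filter.1 he).2
  rw [h1, Nat.add_mul_div_right _ _ (by positivity), Nat.div_eq_of_lt h2, zero_add]

theorem sum_two_pow_bit (E : Finset ℕ) (c : ℕ) :
    (∑ e ∈ E, 2 ^ e) / 2 ^ c % 2 = if c ∈ E then 1 else 0 := by
  rw [sum_two_pow_div, sum_nat_mod]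
  have : ∀ e ∈ E.filter (c ≤ ·), 2 ^ (e - c) % 2 = if e = c then 1 else 0 := by
    intro e he
    have hc := (mem_filter.1 he).2
    split_ifs with h
    · simp [h]
    · obtain ⟨x, hx⟩ : ∃ x, e - c = x + 1 := ⟨e - c - 1, by omega⟩
      rw [hx, pow_succ, Nat.mul_mod_left]
  rw [sum_congr rfl this, sum_ite_eq']
  simp only [mem_filter, le_refl, and_true]
  split_ifs <;> rfl

/-- Positions of distinct agents are distinct, so the key is a sum of distinct powers of two and its
bits can be read off. -/
theorem sig_eq_image (j : ℕ) :
    P.sig j = ∑ e ∈ ({i ∈ range P.n | P.d i j = 1}).image P.pos, 2 ^ e := by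
  rw [sig_eq, sum_image]
  intro i hi a ha h
  simp only [coe_filter, mem_range, Set.mem_ofPred_eq] at hi ha
  exact pos_inj hi.1 ha.1 h

/-- Members of a demand set are not told apart by larger demand sets. -/
theorem mem_iff_of_pos_le (hP : P.IsLaminar) {i a x y : ℕ} (hi : i < P.n) (ha : a < P.n)
    (h : P.pos i ≤ P.pos a) (hx : x ∈ P.D i) (hy : y ∈ P.D i) : P.d a x = 1 ↔ P.d a y = 1 := by
  have hx' := (mem_D.1 hx).1
  have hy' := (mem_D.1 hy).1
  have key : (x ∈ P.D a ↔ y ∈ P.D a) := by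
    rcases hP i hi a ha with h1 | h1 | h1
    · have h2 : ∀ z ∈ P.D i, z ∉ P.D a := fun z hz hz' => by
        have : z ∈ P.D i ∩ P.D a := mem_inter.2 ⟨hz, hz'⟩
        simp [h1] at this
      simp [h2 x hx, h2 y hy]
    · have h2 := inter_eq_left.1 h1
      simp [h2 hx, h2 hy]
    · have h2 := eq_of_subset_of_card_le (inter_eq_right.1 h1) (pos_le ha h)
      rw [h2]
      simp [hx, hy]
  simpa [mem_D, hx', hy'] using key

/-- The bits from `pos i` upwards record membership in demand sets at least as large as `D i`, and
`mem_iff_of_pos_le` says that these agree on `D i`. -/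
theorem sig_div_eq (hP : P.IsLaminar) {i c x y : ℕ} (hi : i < P.n) (hc : P.pos i ≤ c)
    (hx : x ∈ P.D i) (hy : y ∈ P.D i) : P.sig x / 2 ^ c = P.sig y / 2 ^ c := by
  rw [sig_eq_image, sig_eq_image, sum_two_pow_div, sum_two_pow_div]
  congr 1
  ext e
  simp only [mem_filter, mem_image, mem_range]
  refine and_congr_left fun he => exists_congr fun a => and_congr_left fun hae => ?_
  refine and_congr_right fun ha => ?_
  exact mem_iff_of_pos_le hP hi ha (by omega) hx hy

theorem sig_bit {i x : ℕ} (hi : i < P.n) (hx : x < P.m) :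
    P.sig x / 2 ^ P.pos i % 2 = if x ∈ P.D i then 1 else 0 := by
  rw [sig_eq_image, sum_two_pow_bit]
  congr 1
  rw [mem_D, eq_iff_iff]
  simp only [mem_image, mem_filter, mem_range]
  constructor
  · rintro ⟨a, ⟨ha, h1⟩, h2⟩
    exact ⟨hx, pos_inj ha hi h2 ▸ h1⟩
  · rintro ⟨-, h⟩
    exact ⟨i, ⟨hi, h⟩, rfl⟩

/-- Disjoint demand sets are separated by the sort key. -/
theorem separated (hP : P.IsLaminar) {i i' : ℕ} (hi : i < P.n) (hi' : i' < P.n)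
    (hd : Disjoint (P.D i) (P.D i')) :
    (∀ x ∈ P.D i, ∀ y ∈ P.D i', P.sig x < P.sig y) ∨
      ∀ x ∈ P.D i, ∀ y ∈ P.D i', P.sig y < P.sig x := by
  wlog hle : P.pos i' ≤ P.pos i generalizing i i'
  · rcases this hi' hi hd.symm (by omega) with h | h
    · exact .inr fun x hx y hy => h y hy x hx
    · exact .inl fun x hx y hy => h y hy x hx
  rcases (P.D i).eq_empty_or_nonempty with h | ⟨x₀, hx₀⟩
  · simp [h]
  rcases (P.D i').eq_empty_or_nonempty with h | ⟨y₀, hy₀⟩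
  · simp [h]
  -- With the bits below `pos i` cut off, the key is constant on each of the two sets. Its last
  -- remaining bit is one on `D i` and zero on `D i'`, so the two constants differ, and their order
  -- decides the order of all full keys.
  have hx : ∀ x ∈ P.D i, P.sig x / 2 ^ P.pos i = P.sig x₀ / 2 ^ P.pos i :=
    fun x hx => sig_div_eq hP hi le_rfl hx hx₀
  have hy : ∀ y ∈ P.D i', P.sig y / 2 ^ P.pos i = P.sig y₀ / 2 ^ P.pos i :=
    fun y hy => sig_div_eq hP hi' hle hy hy₀
  have h1 := sig_bit hi (mem_D.1 hx₀).1
  have h2 := sig_bit hi (mem_D.1 hy₀).1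
  rw [if_pos hx₀] at h1
  rw [if_neg fun h => disjoint_left.1 hd h hy₀] at h2
  rcases lt_or_ge (P.sig x₀ / 2 ^ P.pos i) (P.sig y₀ / 2 ^ P.pos i) with h | h
  · refine .inl fun x hx' y hy' => ?_
    rw [← hx x hx', ← hy y hy'] at h
    exact lt_of_not_ge fun hc => absurd (Nat.div_le_div_right hc) (not_le.2 h)
  · have h : P.sig y₀ / 2 ^ P.pos i < P.sig x₀ / 2 ^ P.pos i :=
      lt_of_le_of_ne h fun h => by rw [h] at h2; omega
    refine .inr fun x hx' y hy' => ?_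
    rw [← hx x hx', ← hy y hy'] at h
    exact lt_of_not_ge fun hc => absurd (Nat.div_le_div_right hc) (not_le.2 h)

/-! ### Demand sets as intervals in the order of the keys -/

theorem lo_eq (i : ℕ) :
    P.lo i = #{j ∈ range P.m | ∀ j' ∈ P.D i, P.sig j < P.sig j'} := by
  rw [lo, card_eq_sum_ones, sum_filter]
  simp only [mem_D, and_imp]

theorem hi_eq (i : ℕ) :
    P.hi i = #{j ∈ range P.m | ∃ j' ∈ P.D i, P.sig j ≤ P.sig j'} := by
  rw [hi, card_eq_sum_ones, sum_filter]
  simp only [mem_D, and_assoc]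

theorem hi_le (i : ℕ) : P.hi i ≤ P.m := by
  rw [hi_eq]
  exact (card_filter_le _ _).trans (card_range _).le

theorem hi_le_lo {i i' : ℕ} (h : ∀ x ∈ P.D i, ∀ y ∈ P.D i', P.sig x < P.sig y) :
    P.hi i ≤ P.lo i' := by
  rw [hi_eq, lo_eq]
  refine card_le_card (monotone_filter_right _ fun j _ ⟨x, hx, hj⟩ y hy => ?_)
  exact hj.trans_lt (h x hx y hy)

/-- A common project would be counted by `hi i` but not by `lo i'`, while everything counted by `lo
i'` comes before it and is counted by `hi i`. Laminarity plays no role here, so soundness of the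
table does not depend on it. -/
theorem disjoint_of_hi_le_lo {i i' : ℕ} (h : P.hi i ≤ P.lo i') : Disjoint (P.D i) (P.D i') := by
  rw [disjoint_left]
  intro x hx hx'
  refine absurd h (not_le.2 ?_)
  rw [hi_eq, lo_eq]
  refine card_lt_card ⟨monotone_filter_right _ fun j _ hj => ⟨x, hx, (hj x hx').le⟩, fun hs => ?_⟩
  have h1 := hs (mem_filter.2 ⟨mem_range.2 (mem_D.1 hx).1, x, hx, le_rfl⟩)
  exact lt_irrefl _ ((mem_filter.1 h1).2 x hx')

theorem lo_lt_hi {i : ℕ} (h : (P.D i).Nonempty) : P.lo i < P.hi i := by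
  by_contra hc
  obtain ⟨x, hx⟩ := h
  exact disjoint_left.1 (disjoint_of_hi_le_lo (not_lt.1 hc)) hx hx

theorem nonempty_of_hi_pos {i : ℕ} (h : 0 < P.hi i) : (P.D i).Nonempty := by
  rw [hi_eq, card_pos] at h
  obtain ⟨j, hj⟩ := h
  obtain ⟨x, hx, -⟩ := (mem_filter.1 hj).2
  exact ⟨x, hx⟩

theorem hi_le_lo_or (hP : P.IsLaminar) {i i' : ℕ} (hi : i < P.n) (hi' : i' < P.n)
    (hd : Disjoint (P.D i) (P.D i')) : P.hi i ≤ P.lo i' ∨ P.hi i' ≤ P.lo i := by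
  rcases separated hP hi hi' hd with h | h
  · exact .inl (hi_le_lo h)
  · exact .inr (hi_le_lo fun y hy x hx => h x hx y hy)

/-! ### The table -/

theorem cell_zero {g q : ℕ} (hq : q < P.cols) :
    P.cell g 0 q = if q = 0 then P.offset * 2 ^ P.m else 0 := by
  rw [cell, RAM.recTable, entry]
  simp [hq]

/-- For `hi i = p + 1` the demand set is nonempty, so `lo i ≤ p` and the entry that is read lies
before the current one; the default zero of `recTable` does not interfere. -/
theorem cell_succ {g p q : ℕ} (hq : q < P.cols) :
    P.cell g (p + 1) q = max (P.cell g p q) ((range P.n).sup fun i =>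
      if P.hi i = p + 1 ∧ P.Adm g i ∧ P.wt g i ≤ q ∧ P.cell g (P.lo i) (q - P.wt g i) ≠ 0 then
        P.cell g (P.lo i) (q - P.wt g i) + (P.bud i * 2 ^ P.m + P.mask i) - P.cst i * 2 ^ P.m
      else 0) := by
  have hexp : (p + 1) * P.cols = p * P.cols + P.cols := by ring
  have hdiv : ((p + 1) * P.cols + q) / P.cols = p + 1 := by
    rw [add_comm, Nat.add_mul_div_right _ _ (by omega), Nat.div_eq_of_lt hq, zero_add]
  have hmod : ((p + 1) * P.cols + q) % P.cols = q := by
    rw [add_comm, Nat.add_mul_mod_self_right, Nat.mod_eq_of_lt hq]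
  rw [cell, RAM.recTable, entry, if_neg (by omega), hdiv, hmod]
  have h1 : (p + 1) * P.cols + q - P.cols = p * P.cols + q := by omega
  rw [h1, if_pos (by omega)]
  change max (P.cell g p q) _ = _
  congr 2
  funext i
  by_cases hhi : P.hi i = p + 1
  · have hlo : P.lo i ≤ p := by
      have := lo_lt_hi (nonempty_of_hi_pos (P := P) (i := i) (by omega))
      omega
    have hlt : P.lo i * P.cols + (q - P.wt g i) < (p + 1) * P.cols + q := by
      have := Nat.mul_le_mul_right P.cols hlo
      omega
    simp only [if_pos hlt]
    rfl
  · simp [hhi]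

/-- Families of disjoint demand sets among the first `p` projects. -/
structure Fam (P : Scaled) (g p : ℕ) (A : Finset ℕ) : Prop where
  lt : ∀ i ∈ A, i < P.n
  adm : ∀ i ∈ A, P.Adm g i
  nonempty : ∀ i ∈ A, (P.D i).Nonempty
  hi_le : ∀ i ∈ A, P.hi i ≤ p
  disj : (A : Set ℕ).PairwiseDisjoint P.D

theorem sum_cst_eq {A : Finset ℕ} (h : (A : Set ℕ).PairwiseDisjoint P.D) :
    ∑ i ∈ A, P.cst i = ∑ j ∈ A.biUnion P.D, P.C j := by
  rw [sum_biUnion h]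
  exact sum_congr rfl fun i _ => cst_eq i

theorem biUnion_D_subset (A : Finset ℕ) : A.biUnion P.D ⊆ range P.m :=
  biUnion_subset.2 fun _ _ => filter_subset _ _

theorem sum_cst_lt {A : Finset ℕ} (h : (A : Set ℕ).PairwiseDisjoint P.D) :
    ∑ i ∈ A, P.cst i < P.offset := by
  rw [sum_cst_eq h, offset]
  exact Nat.lt_succ_of_le (sum_le_sum_of_subset (biUnion_D_subset A))

theorem sum_mask_eq {A : Finset ℕ} (h : (A : Set ℕ).PairwiseDisjoint P.D) :
    ∑ i ∈ A, P.mask i = ∑ j ∈ A.biUnion P.D, 2 ^ j := by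
  rw [sum_biUnion h]
  exact sum_congr rfl fun i _ => mask_eq i

theorem sum_mask_lt {A : Finset ℕ} (h : (A : Set ℕ).PairwiseDisjoint P.D) :
    ∑ i ∈ A, P.mask i < 2 ^ P.m := by
  rw [sum_mask_eq h]
  exact Nat.geomSum_lt le_rfl fun j hj => mem_range.1 (biUnion_D_subset A hj)

/-- Every nonzero entry of the table comes from a family. -/
theorem exists_fam {g p q : ℕ} (hq : q < P.cols) (h : P.cell g p q ≠ 0) :
    ∃ A, P.Fam g p A ∧ ∑ i ∈ A, P.wt g i = q ∧
      P.cell g p q + (∑ i ∈ A, P.cst i) * 2 ^ P.m =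
        (P.offset + ∑ i ∈ A, P.bud i) * 2 ^ P.m + ∑ i ∈ A, P.mask i := by
  induction p using Nat.strong_induction_on generalizing q with
  | _ p ih =>
    cases p with
    | zero =>
      rw [cell_zero hq] at h ⊢
      have hq0 : q = 0 := by
        by_contra hc
        simp [hc] at h
      subst hq0
      exact ⟨∅, ⟨by simp, by simp, by simp, by simp, by simp⟩, by simp, by simp⟩
    | succ p =>
      have hmono : ∀ {p' A}, p' ≤ p + 1 → P.Fam g p' A → P.Fam g (p + 1) A := fun hp hA =>
        ⟨hA.lt, hA.adm, hA.nonempty, fun i hi => (hA.hi_le i hi).trans hp, hA.disj⟩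
      rcases max_choice (P.cell g p q) ((range P.n).sup fun i =>
        if P.hi i = p + 1 ∧ P.Adm g i ∧ P.wt g i ≤ q ∧ P.cell g (P.lo i) (q - P.wt g i) ≠ 0 then
          P.cell g (P.lo i) (q - P.wt g i) + (P.bud i * 2 ^ P.m + P.mask i) - P.cst i * 2 ^ P.m
        else 0) with hmax | hmax
      · rw [cell_succ hq, hmax] at h ⊢
        obtain ⟨A, hA, h1, h2⟩ := ih p (by omega) hq h
        exact ⟨A, hmono (by omega) hA, h1, h2⟩
      · rw [cell_succ hq, hmax] at h ⊢
        have hne : (range P.n).Nonempty := by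
          by_contra hc
          rw [not_nonempty_iff_eq_empty.1 hc] at h
          simp at h
        obtain ⟨i, hi, hsup⟩ := exists_mem_eq_sup (range P.n) hne (fun i =>
          if P.hi i = p + 1 ∧ P.Adm g i ∧ P.wt g i ≤ q ∧ P.cell g (P.lo i) (q - P.wt g i) ≠ 0 then
            P.cell g (P.lo i) (q - P.wt g i) + (P.bud i * 2 ^ P.m + P.mask i) - P.cst i * 2 ^ P.m
          else 0)
        rw [hsup] at h ⊢
        simp only [ne_eq, ite_eq_right_iff, Classical.not_imp] at h
        obtain ⟨hcond, -⟩ := h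
        rw [if_pos hcond]
        obtain ⟨h1, h2, h3, h4⟩ := hcond
        have hine := nonempty_of_hi_pos (P := P) (i := i) (by omega)
        have hlo := lo_lt_hi hine
        obtain ⟨A, hA, hA1, hA2⟩ := ih (P.lo i) (by omega) (q := q - P.wt g i) (by omega) h4
        have hiA : i ∉ A := fun hc => absurd (hA.hi_le i hc) (by omega)
        have hdisj : ((insert i A : Finset ℕ) : Set ℕ).PairwiseDisjoint P.D := by
          rw [coe_insert]
          refine hA.disj.insert fun a ha _ => ?_
          exact (disjoint_of_hi_le_lo (hA.hi_le a ha)).symm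
        refine ⟨insert i A, ⟨?_, ?_, ?_, ?_, hdisj⟩, ?_, ?_⟩
        · exact forall_mem_insert .. |>.2 ⟨mem_range.1 hi, hA.lt⟩
        · exact forall_mem_insert .. |>.2 ⟨h2, hA.adm⟩
        · exact forall_mem_insert .. |>.2 ⟨hine, hA.nonempty⟩
        · exact forall_mem_insert .. |>.2 ⟨h1.le, fun a ha => (hA.hi_le a ha).trans (by omega)⟩
        · rw [sum_insert hiA, hA1]; omega
        -- `offset` exceeds the cost of the whole family, so the truncated subtraction in the table
        -- is exact.
        · have hlt := sum_cst_lt hdisj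
          rw [sum_insert hiA] at hlt
          rw [sum_insert hiA, sum_insert hiA, sum_insert hiA]
          have h5 : (P.cst i + ∑ x ∈ A, P.cst x) * 2 ^ P.m ≤ P.offset * 2 ^ P.m :=
            Nat.mul_le_mul_right _ hlt.le
          simp only [add_mul] at *
          omega

/-- The entries of the table are at least the values of the families. -/
theorem le_cell (hP : P.IsLaminar) {g p : ℕ} {A : Finset ℕ} (hA : P.Fam g p A)
    (hq : ∑ i ∈ A, P.wt g i < P.cols) :
    (P.offset + ∑ i ∈ A, P.bud i) * 2 ^ P.m + ∑ i ∈ A, P.mask i ≤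
      P.cell g p (∑ i ∈ A, P.wt g i) + (∑ i ∈ A, P.cst i) * 2 ^ P.m := by
  induction p using Nat.strong_induction_on generalizing A with
  | _ p ih =>
    cases p with
    | zero =>
      have : A = ∅ := by
        rw [eq_empty_iff_forall_notMem]
        intro i hi
        have := hA.hi_le i hi
        have := lo_lt_hi (hA.nonempty i hi)
        omega
      subst this
      rw [cell_zero hq]
      simp
    | succ p =>
      by_cases hex : ∃ i ∈ A, P.hi i = p + 1
      · obtain ⟨i, hi, hip⟩ := hex
        have hin := hA.lt i hi
        have hlo := lo_lt_hi (hA.nonempty i hi)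
        have hB : P.Fam g (P.lo i) (A.erase i) := by
          refine ⟨fun a ha => hA.lt a (mem_of_mem_erase ha),
            fun a ha => hA.adm a (mem_of_mem_erase ha),
            fun a ha => hA.nonempty a (mem_of_mem_erase ha), fun a ha => ?_,
            hA.disj.subset (by simp)⟩
          have haA := mem_of_mem_erase ha
          -- No other member can begin after the end of `D i`, because `hi i = p + 1` is already the
          -- largest end allowed.
          rcases hi_le_lo_or hP (hA.lt a haA) hin (hA.disj haA hi (ne_of_mem_erase ha)) with h | h
          · exact h
          · have := hA.hi_le a haA
            have := lo_lt_hi (hA.nonempty a haA)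
            omega
        rw [← add_sum_erase A _ hi, ← add_sum_erase A _ hi, ← add_sum_erase A _ hi,
          ← add_sum_erase A _ hi] at *
        set q := ∑ x ∈ A.erase i, P.wt g x
        have h1 := ih (P.lo i) (by omega) hB (by omega)
        change _ ≤ P.cell g (P.lo i) q + _ at h1
        have hlt := sum_cst_lt hB.disj
        -- Since `offset` exceeds every cost, the entry of an existing family is not confused with
        -- the zero that marks absence.
        have h2 : P.cell g (P.lo i) q ≠ 0 := by
          intro h0
          rw [h0] at h1
          have : (∑ x ∈ A.erase i, P.cst x) * 2 ^ P.m < P.offset * 2 ^ P.m :=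
            Nat.mul_lt_mul_of_pos_right hlt (by positivity)
          simp only [add_mul] at h1
          omega
        have h3 : P.cell g (P.lo i) q + (P.bud i * 2 ^ P.m + P.mask i) - P.cst i * 2 ^ P.m ≤
            P.cell g (p + 1) (P.wt g i + q) := by
          rw [cell_succ hq]
          refine le_trans ?_ (le_max_right _ _)
          refine le_trans ?_ (le_sup (mem_range.2 hin))
          have h4 : P.wt g i + q - P.wt g i = q := by omega
          simp only [h4]
          rw [if_pos ⟨hip, hA.adm i hi, by omega, h2⟩]
        simp only [add_mul] at *
        omega
      · push Not at hex
        have hB : P.Fam g p A := ⟨hA.lt, hA.adm, hA.nonempty, fun i hi => by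
          have := hA.hi_le i hi
          have := hex i hi
          omega, hA.disj⟩
        refine (ih p (by omega) hB hq).trans (Nat.add_le_add_right ?_ _)
        rw [cell_succ hq]
        exact le_max_left _ _

/-! ### The approximation guarantee -/

/-- The set of projects with bit mask `w`. -/
def bitSet (P : Scaled) (w : ℕ) : Finset ℕ := {j ∈ range P.m | w / 2 ^ j % 2 = 1}

/-- Sum of `f` over the agents whose demand sets are contained in `W`. -/
noncomputable def satSum (P : Scaled) (f : ℕ → ℕ) (W : Finset ℕ) : ℕ :=
  ∑ a ∈ range P.n, if P.D a ⊆ W then f a else 0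

theorem sat_iff {i w : ℕ} : P.Sat i w ↔ P.D i ⊆ P.bitSet w := by
  refine ⟨fun h j hj => ?_, fun h j hj h1 => ?_⟩
  · rw [mem_D] at hj
    exact mem_filter.2 ⟨mem_range.2 hj.1, h j hj.1 hj.2⟩
  · exact (mem_filter.1 (h (mem_D.2 ⟨hj, h1⟩))).2

theorem maskVal_eq (w : ℕ) : P.maskVal w = P.satSum P.Z (P.bitSet w) := by
  simp only [maskVal, satSum, sat_iff]

theorem maskBud_eq (w : ℕ) : P.maskBud w = P.satSum P.β (P.bitSet w) := by
  simp only [maskBud, satSum, sat_iff]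

theorem maskCst_eq (w : ℕ) : P.maskCst w = ∑ j ∈ P.bitSet w, P.C j := by
  rw [maskCst, bitSet, sum_filter]

theorem bitSet_zero : P.bitSet 0 = ∅ := by simp [bitSet]

theorem bitSet_sum {W : Finset ℕ} (hW : W ⊆ range P.m) : P.bitSet (∑ j ∈ W, 2 ^ j) = W := by
  ext j
  rw [bitSet, mem_filter, sum_two_pow_bit]
  constructor
  · rintro ⟨-, h⟩
    by_contra hc
    simp [hc] at h
  · exact fun h => ⟨hW h, by simp [h]⟩

/-- A union of disjoint demand sets satisfies at least the agents below its members. -/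
theorem add_sum_le_satSum (f : ℕ → ℕ) {g p : ℕ} {A : Finset ℕ} (hA : P.Fam g p A) :
    P.satSum f ∅ + ∑ i ∈ A, ∑ a ∈ range P.n, (if P.Below a i then f a else 0) ≤
      P.satSum f (A.biUnion P.D) := by
  rw [sum_comm, satSum, satSum, ← sum_add_distrib]
  refine sum_le_sum fun a _ => ?_
  simp only [below_iff, subset_empty]
  rcases (P.D a).eq_empty_or_nonempty with h | h
  · simp [h]
  rw [if_neg h.ne_empty, zero_add]
  simp only [h, and_true]
  -- By disjointness a nonempty demand set is below at most one member. Only an inequality holds in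
  -- general: the union may contain a demand set that lies in no single member.
  by_cases hex : ∃ i ∈ A, P.D a ⊆ P.D i
  · obtain ⟨i, hi, hai⟩ := hex
    rw [sum_eq_single i, if_pos hai, if_pos (hai.trans (subset_biUnion_of_mem P.D hi))]
    · intro i' hi' hne
      rw [if_neg]
      intro hai'
      obtain ⟨x, hx⟩ := h
      exact disjoint_left.1 (hA.disj hi' hi hne) (hai' hx) (hai hx)
    · exact fun h => absurd hi h
  · push Not at hex
    rw [sum_eq_zero fun i hi => if_neg (hex i hi)]
    exact Nat.zero_le _

/-- The agents satisfied by `W` are below disjoint demand sets contained in `W`. -/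
theorem exists_maximal (hP : P.IsLaminar) (W : Finset ℕ) :
    ∃ M : Finset ℕ, (∀ i ∈ M, i < P.n ∧ P.D i ⊆ W ∧ (P.D i).Nonempty) ∧
      (M : Set ℕ).PairwiseDisjoint P.D ∧
      ∀ f : ℕ → ℕ, P.satSum f W ≤
        P.satSum f ∅ + ∑ i ∈ M, ∑ a ∈ range P.n, (if P.Below a i then f a else 0) := by
  -- Maximality is measured by `pos` rather than by inclusion, which selects exactly one agent among
  -- those with equal demand sets.
  let M := {i ∈ range P.n | P.D i ⊆ W ∧ (P.D i).Nonempty ∧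
    ∀ a < P.n, P.D a ⊆ W → P.D i ⊆ P.D a → P.pos a ≤ P.pos i}
  have hM : ∀ {i}, i ∈ M ↔ i < P.n ∧ P.D i ⊆ W ∧ (P.D i).Nonempty ∧
      ∀ a < P.n, P.D a ⊆ W → P.D i ⊆ P.D a → P.pos a ≤ P.pos i := by simp [M]
  have hsub : ∀ {i a}, i ∈ M → a ∈ M → P.D i ⊆ P.D a → i = a := by
    intro i a hi ha h
    have h1 := (hM.1 hi).2.2.2 a (hM.1 ha).1 (hM.1 ha).2.1 h
    have h2 := eq_of_subset_of_card_le h (pos_le (hM.1 hi).1 h1)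
    have h3 := (hM.1 ha).2.2.2 i (hM.1 hi).1 (hM.1 hi).2.1 h2.ge
    exact pos_inj (hM.1 hi).1 (hM.1 ha).1 (le_antisymm h3 h1)
  refine ⟨M, fun i hi => ⟨(hM.1 hi).1, (hM.1 hi).2.1, (hM.1 hi).2.2.1⟩, ?_, fun f => ?_⟩
  · intro i hi a ha hne
    rw [mem_coe] at hi ha
    rcases hP i (hM.1 hi).1 a (hM.1 ha).1 with h | h | h
    · exact disjoint_iff_inter_eq_empty.2 h
    · exact absurd (hsub hi ha (inter_eq_left.1 h)) hne
    · exact absurd (hsub ha hi (inter_eq_right.1 h)).symm hne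
  · rw [sum_comm, satSum, satSum, ← sum_add_distrib]
    refine sum_le_sum fun a ha => ?_
    rw [mem_range] at ha
    split_ifs with h1 h2
    · exact Nat.le_add_right _ _
    · rw [subset_empty, ← Ne, ← nonempty_iff_ne_empty] at h2
      obtain ⟨i, hi, hmax⟩ := exists_max_image {i ∈ range P.n | P.D a ⊆ P.D i ∧ P.D i ⊆ W} P.pos
        ⟨a, by simp [ha, h1]⟩
      simp only [mem_filter, mem_range] at hi hmax
      have hiM : i ∈ M := hM.2 ⟨hi.1, hi.2.2, h2.mono hi.2.1,
        fun b hb hbW hib => hmax b ⟨hb, hi.2.1.trans hib, hbW⟩⟩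
      rw [zero_add]
      refine le_trans ?_ (single_le_sum (fun _ _ => Nat.zero_le _) hiM)
      rw [if_pos (below_iff.2 ⟨hi.2.1, h2⟩)]
    · exact Nat.zero_le _
    · exact Nat.zero_le _

/-- Each candidate carries its own mask, and `cand` checks affordability on that mask, so the
property passes to maxima. Neither laminarity nor correctness of the table enters; the zero of a
rejected candidate stands for the empty bundle. -/
theorem out_spec : P.maskCst P.out ≤ P.maskBud P.out ∧
    P.best / 2 ^ P.m ≤ P.maskVal P.out - P.maskCst P.out := by
  let Good : ℕ → Prop := fun x => P.maskCst (x % 2 ^ P.m) ≤ P.maskBud (x % 2 ^ P.m) ∧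
    x / 2 ^ P.m ≤ P.maskVal (x % 2 ^ P.m) - P.maskCst (x % 2 ^ P.m)
  have hc0 : P.maskCst 0 = 0 := by rw [maskCst_eq, bitSet_zero, sum_empty]
  have h0 : Good 0 := by simp [Good, hc0]
  have hmax : ∀ x, Good x → ∀ y, Good y → Good (max x y) := fun x hx y hy => by
    rcases max_choice x y with h | h <;> rw [h] <;> assumption
  change Good P.best
  refine hmax _ ?_ _ (sup_induction h0 hmax fun g _ => sup_induction h0 hmax fun q _ => ?_)
  · simp only [Good, Nat.mul_mod_left, hc0]
    rw [Nat.mul_div_cancel _ (by positivity)]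
    simp
  · have hlt : P.cell g P.m q % 2 ^ P.m < 2 ^ P.m := Nat.mod_lt _ (by positivity)
    generalize P.cell g P.m q % 2 ^ P.m = w at hlt
    rw [cand]
    split_ifs with h
    · simp only [Good]
      have h1 : ((P.maskVal w - P.maskCst w) * 2 ^ P.m + w) % 2 ^ P.m = w := by
        rw [add_comm, Nat.add_mul_mod_self_right, Nat.mod_eq_of_lt hlt]
      have h2 : ((P.maskVal w - P.maskCst w) * 2 ^ P.m + w) / 2 ^ P.m =
          P.maskVal w - P.maskCst w := by
        rw [add_comm, Nat.add_mul_div_right _ _ (by positivity), Nat.div_eq_of_lt hlt, zero_add]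
      rw [h1, h2]
      exact ⟨h, le_rfl⟩
    · exact h0

theorem le_of_le_best {v w : ℕ} (h : v * 2 ^ P.m + w ≤ P.best) :
    v ≤ P.maskVal P.out - P.maskCst P.out := by
  refine le_trans ?_ out_spec.2
  rw [Nat.le_div_iff_mul_le (by positivity)]
  omega

theorem wt_le {g i : ℕ} (h : P.Adm g i) : P.wt g i ≤ P.n * P.k := by
  refine Nat.div_le_of_le_mul ?_
  rw [mul_assoc]
  exact Nat.mul_le_mul_right _ h.2

/-- Here `w` and `w'` are the gains of the optimal and of the computed family and `L` is the largest
gain. Rounding loses at most one unit `L / (n * k)` for each of `c ≤ n` members, in total at most `L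
/ k ≤ w / k`. -/
theorem approx_aux {w w' L n k q c : ℕ} (hn : 0 < n) (h1 : L * q ≤ w' * n * k)
    (h2 : w * n * k ≤ L * q + L * c) (hc : c ≤ n) (hL : L ≤ w) : k * w ≤ k * w' + w := by
  have h3 : L * c ≤ w * n := Nat.mul_le_mul hL hc
  refine Nat.le_of_mul_le_mul_left ?_ hn
  calc n * (k * w) = w * n * k := by ring
    _ ≤ w' * n * k + w * n := by omega
    _ = n * (k * w' + w) := by ring

/-- The computed set of projects is nearly optimal. -/
theorem approx (hP : P.IsLaminar) (hβ : ∀ i, P.β i ≤ P.Z i) {W : Finset ℕ}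
    (hW : ∑ j ∈ W, P.C j ≤ P.satSum P.β W) :
    P.k * (P.satSum P.Z W - ∑ j ∈ W, P.C j) ≤
      P.k * (P.maskVal P.out - P.maskCst P.out) + (P.satSum P.Z W - ∑ j ∈ W, P.C j) := by
  obtain ⟨M, hM, hMd, hMf⟩ := exists_maximal hP W
  have hV := hMf P.Z
  have hB := hMf P.β
  change _ ≤ _ + ∑ i ∈ M, P.val i at hV
  change _ ≤ _ + ∑ i ∈ M, P.bud i at hB
  have hC : ∑ i ∈ M, P.cst i ≤ ∑ j ∈ W, P.C j := by
    rw [sum_cst_eq hMd]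
    exact sum_le_sum_of_subset (biUnion_subset.2 fun i hi => (hM i hi).2.1)
  have hbv : ∀ i, P.bud i ≤ P.val i := fun i => sum_le_sum fun a _ => by
    split_ifs
    · exact hβ a
    · exact le_rfl
  -- The discarded members satisfy `bud ≤ val ≤ cst`: removing them lowers neither the welfare nor
  -- the surplus.
  set A := {i ∈ M | P.cst i < P.val i} with hA
  have hAM : A ⊆ M := filter_subset _ _
  have hsplit : ∀ f : ℕ → ℕ, ∑ i ∈ M, f i = ∑ i ∈ A, f i + ∑ i ∈ M with ¬ P.cst i < P.val i, f i :=
    fun f => (sum_filter_add_sum_filter_not M _ f).symm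
  have hrest : ∑ i ∈ M with ¬ P.cst i < P.val i, P.val i ≤
      ∑ i ∈ M with ¬ P.cst i < P.val i, P.cst i :=
    sum_le_sum fun i hi => not_lt.1 (mem_filter.1 hi).2
  have hrest' : ∑ i ∈ M with ¬ P.cst i < P.val i, P.bud i ≤
      ∑ i ∈ M with ¬ P.cst i < P.val i, P.val i := sum_le_sum fun i _ => hbv i
  rw [hsplit] at hV hB hC
  have hgain : ∀ B : Finset ℕ, (∀ i ∈ B, P.cst i < P.val i) →
      ∑ i ∈ B, P.val i = ∑ i ∈ B, P.cst i + ∑ i ∈ B, P.gain i := fun B hB => by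
    rw [← sum_add_distrib]
    refine sum_congr rfl fun i hi => ?_
    have := hB i hi
    simp only [gain]; omega
  have hgA := hgain A fun i hi => (mem_filter.1 hi).2
  have hopt : P.satSum P.Z W - ∑ j ∈ W, P.C j ≤ P.satSum P.Z ∅ + ∑ i ∈ A, P.gain i := by omega
  have hsur : ∑ i ∈ A, P.cst i ≤ P.satSum P.β ∅ + ∑ i ∈ A, P.bud i := by omega
  -- Without a profitable member, only agents with empty demand sets contribute, and the empty
  -- bundle serves them at no cost.
  rcases A.eq_empty_or_nonempty with hAe | hAne
  · have h1 : P.maskVal 0 ≤ P.maskVal P.out - P.maskCst P.out := by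
      refine le_of_le_best (w := 0) ?_
      rw [add_zero]
      exact le_max_left _ _
    rw [maskVal_eq 0, bitSet_zero] at h1
    rw [hAe, sum_empty, add_zero] at hopt
    exact (Nat.mul_le_mul_left _ (hopt.trans h1)).trans (Nat.le_add_right _ _)
  obtain ⟨g, hg, hgmax⟩ := exists_max_image A P.gain hAne
  have hfam : P.Fam g P.m A := ⟨fun i hi => (hM i (hAM hi)).1,
    fun i hi => ⟨(mem_filter.1 hi).2, hgmax i hi⟩, fun i hi => (hM i (hAM hi)).2.2,
    fun i _ => hi_le i, hMd.subset (coe_subset.2 hAM)⟩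
  have hgn := hfam.lt g hg
  have hcard : #A ≤ P.n := by
    simpa using card_le_card (fun i hi => mem_range.2 (hfam.lt i hi) : A ⊆ range P.n)
  have hgpos : 0 < P.gain g := by
    have := (mem_filter.1 hg).2
    simp only [gain]; omega
  set q := ∑ i ∈ A, P.wt g i with hq
  have hqlt : q < P.cols := by
    refine Nat.lt_succ_of_le ((sum_le_card_nsmul _ _ _ fun i hi => wt_le (hfam.adm i hi)).trans ?_)
    rw [smul_eq_mul, mul_assoc]
    exact Nat.mul_le_mul_right _ hcard
  have hle := le_cell hP hfam hqlt
  rw [← hq] at hle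
  have hpos : P.cell g P.m q ≠ 0 := by
    intro h0
    rw [h0] at hle
    have : (∑ x ∈ A, P.cst x) * 2 ^ P.m < P.offset * 2 ^ P.m :=
      Nat.mul_lt_mul_of_pos_right (sum_cst_lt hfam.disj) (by positivity)
    simp only [add_mul] at hle
    omega
  -- The entry may belong to a different family `B`, which has the same rounded welfare as `A` and
  -- at least its surplus.
  obtain ⟨B, hBfam, hBq, hBcell⟩ := exists_fam hqlt hpos
  have hmA := sum_mask_lt hfam.disj
  have hmB := sum_mask_lt hBfam.disj
  have hltB := sum_cst_lt hBfam.disj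
  have hmod : P.cell g P.m q % 2 ^ P.m = ∑ i ∈ B, P.mask i := by
    have h1 := congrArg (· % 2 ^ P.m) hBcell
    simp only [Nat.add_mul_mod_self_right] at h1
    rw [h1, add_comm, Nat.add_mul_mod_self_right, Nat.mod_eq_of_lt hmB]
  -- Masks are below `2 ^ m`, so they cannot outweigh a unit of surplus in the comparison of encoded
  -- entries.
  have hcmp : ∑ i ∈ A, P.bud i + ∑ i ∈ B, P.cst i ≤ ∑ i ∈ B, P.bud i + ∑ i ∈ A, P.cst i := by
    by_contra hc
    have h1 : (∑ i ∈ B, P.bud i + ∑ i ∈ A, P.cst i + 1) * 2 ^ P.m ≤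
      (∑ i ∈ A, P.bud i + ∑ i ∈ B, P.cst i) * 2 ^ P.m := Nat.mul_le_mul_right _ (by omega)
    simp only [add_mul, one_mul] at h1 hle hBcell
    omega
  have hset : P.bitSet (P.cell g P.m q % 2 ^ P.m) = B.biUnion P.D := by
    rw [hmod, sum_mask_eq hBfam.disj, bitSet_sum (biUnion_D_subset B)]
  have hVB := add_sum_le_satSum P.Z hBfam
  have hBB := add_sum_le_satSum P.β hBfam
  change _ + ∑ i ∈ B, P.val i ≤ _ at hVB
  change _ + ∑ i ∈ B, P.bud i ≤ _ at hBB
  rw [← hset] at hVB hBB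
  have hCB := sum_cst_eq hBfam.disj
  rw [← hset] at hCB
  rw [← maskVal_eq] at hVB
  rw [← maskBud_eq] at hBB
  rw [← maskCst_eq] at hCB
  have hgB := hgain B fun i hi => (hBfam.adm i hi).1
  have hfound : P.satSum P.Z ∅ + ∑ i ∈ B, P.gain i ≤ P.maskVal P.out - P.maskCst P.out := by
    refine le_trans ?_ (le_of_le_best (w := P.cell g P.m q % 2 ^ P.m)
      (v := P.maskVal (P.cell g P.m q % 2 ^ P.m) - P.maskCst (P.cell g P.m q % 2 ^ P.m)) ?_)
    · omega
    · refine le_trans ?_ (le_max_right _ _)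
      refine le_trans ?_ (le_sup (mem_range.2 hgn))
      refine le_trans ?_ (le_sup (mem_range.2 hqlt))
      rw [cand, if_pos (by omega)]
  have haux : P.k * ∑ i ∈ A, P.gain i ≤ P.k * ∑ i ∈ B, P.gain i + ∑ i ∈ A, P.gain i := by
    refine approx_aux (L := P.gain g) (n := P.n) (q := q) (c := #A) (by omega) ?_ ?_ hcard
      (single_le_sum (fun _ _ => Nat.zero_le _) hg)
    · rw [← hBq, mul_sum, sum_mul, sum_mul]
      exact sum_le_sum fun i _ => Nat.mul_div_le _ _
    · rw [hq, sum_mul, sum_mul, mul_sum, mul_comm (P.gain g) #A, ← smul_eq_mul #A, ← sum_const,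
        ← sum_add_distrib]
      refine sum_le_sum fun i _ => ?_
      have := Nat.lt_mul_div_succ (P.gain i * P.n * P.k) hgpos
      rw [mul_add, mul_one] at this
      exact this.le
  generalize P.satSum P.Z W - ∑ j ∈ W, P.C j = x at *
  generalize P.maskVal P.out - P.maskCst P.out = y at *
  rcases Nat.eq_zero_or_pos P.k with hk | hk
  · simp [hk]
  -- With accuracy `k + 1` the claim reads `k * x ≤ (k + 1) * y`. The value of the empty demand sets
  -- is not rounded and enters both sides in full.
  obtain ⟨k, hk⟩ : ∃ k, P.k = k + 1 := ⟨P.k - 1, by omega⟩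
  rw [hk] at haux ⊢
  have h1 : k * x ≤ k * (P.satSum P.Z ∅ + ∑ i ∈ A, P.gain i) := Nat.mul_le_mul_left _ hopt
  have h2 : (k + 1) * (P.satSum P.Z ∅ + ∑ i ∈ B, P.gain i) ≤ (k + 1) * y :=
    Nat.mul_le_mul_left _ hfound
  nlinarith

end Scaled

namespace RAM

/-! ### The algorithm runs in polynomial time -/

/-- Cell `i` of input array `c`. -/
def Query.cell (q : Query) (c i : ℕ) : ℕ := (q.inst.input q.acc).arr c i

/-- A common denominator. -/
def Query.den (q : Query) : ℕ :=
  (∏ i ∈ range q.inst.n, q.cell 1 i * q.cell 3 i) * ∏ j ∈ range q.inst.m, q.cell 5 j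

/-- The instance, multiplied by a common denominator. -/
def Query.scaled (q : Query) : Scaled where
  n := q.inst.n
  m := q.inst.m
  k := q.acc
  d i j := q.cell 6 (i * q.inst.m + j)
  Z i := q.cell 0 i * (q.den / q.cell 1 i)
  β i := min (q.cell 0 i * (q.den / q.cell 1 i)) (q.cell 2 i * (q.den / q.cell 3 i))
  C j := q.cell 4 j * (q.den / q.cell 5 j)

open Ctx Classical

variable {α : Type} [Ctx α]

/-- The scaled instance of a context. -/
def sc (a : α) : Scaled := (query a).scaled

namespace PolyTime

theorem cell {i : α → ℕ} (c : ℕ) (hc : c < 7) (hi : PolyTime i) :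
    PolyTime (fun a => (query a).cell c (i a)) := input c hc hi

theorem den : PolyTime (fun a : α => (query a).den) :=
  (prod (f := fun a i => (query a).cell 1 i * (query a).cell 3 i) .agents
    ((cell 1 (by omega) snd).mul (cell 3 (by omega) snd))).mul
  (prod (f := fun a i => (query a).cell 5 i) .projects (cell 5 (by omega) snd))

variable {i j w : α → ℕ}

theorem d (hi : PolyTime i) (hj : PolyTime j) : PolyTime (fun a => (sc a).d (i a) (j a)) :=
  cell 6 (by omega) ((hi.mul Small.projects.1).add hj)

theorem Z (hi : PolyTime i) : PolyTime (fun a => (sc a).Z (i a)) :=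
  (cell 0 (by omega) hi).mul (den.div (cell 1 (by omega) hi))

theorem β (hi : PolyTime i) : PolyTime (fun a => (sc a).β (i a)) :=
  ((cell 0 (by omega) hi).mul (den.div (cell 1 (by omega) hi))).min
    ((cell 2 (by omega) hi).mul (den.div (cell 3 (by omega) hi)))

theorem C (hi : PolyTime i) : PolyTime (fun a => (sc a).C (i a)) :=
  (cell 4 (by omega) hi).mul (den.div (cell 5 (by omega) hi))

end PolyTime

theorem Small.n : Small (fun a : α => (sc a).n) := .agents

theorem Small.m : Small (fun a : α => (sc a).m) := .projects

theorem Small.k : Small (fun a : α => (sc a).k) := .accuracy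

variable {i j g w : α → ℕ}

theorem PolyDec.d (hi : PolyTime i) (hj : PolyTime j) :
    PolyDec (fun a => (sc a).d (i a) (j a) = 1) := .eq (.d hi hj) (.const 1)

theorem Small.card (hi : PolyTime i) : Small (fun a => (sc a).card (i a)) :=
  Small.sum (f := fun a j => if (sc a).d (i a) j = 1 then 1 else 0) .m
    (.ite (.d hi.fst .snd) (.const 1) (.const 0))

theorem Small.pos (hi : Small i) : Small (fun a => (sc a).pos (i a)) :=
  ((Small.card hi.1).mul .n).add hi

theorem PolyTime.two_pow (hi : Small i) : PolyTime (fun a => 2 ^ i a) := .pow (.const 2) hi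

theorem PolyTime.sig (hj : PolyTime j) : PolyTime (fun a => (sc a).sig (j a)) :=
  .sum (f := fun a i => if (sc a).d i (j a) = 1 then 2 ^ (sc a).pos i else 0) .n
    (.ite (.d .snd hj.fst) (.two_pow (Small.pos (α := α × ℕ) .snd)) (.const 0))

theorem Small.lo (hi : PolyTime i) : Small (fun a => (sc a).lo (i a)) := by
  unfold Scaled.lo
  exact Small.sum .m
    (.ite (.ball
      (P := fun (p : α × ℕ) j' => (sc p).d (i p.1) j' = 1 → (sc p).sig p.2 < (sc p).sig j')
      .m (.imp (.d hi.fst.fst .snd) (.lt (.sig (α := (α × ℕ) × ℕ) (.fst .snd))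
        (.sig (α := (α × ℕ) × ℕ) .snd)))) (.const 1) (.const 0))

theorem Small.hi (hi : PolyTime i) : Small (fun a => (sc a).hi (i a)) := by
  unfold Scaled.hi
  exact Small.sum .m
    (.ite (.bex
      (P := fun (p : α × ℕ) j' => (sc p).d (i p.1) j' = 1 ∧ (sc p).sig p.2 ≤ (sc p).sig j')
      .m (.and (.d hi.fst.fst .snd) (.le (.sig (α := (α × ℕ) × ℕ) (.fst .snd))
        (.sig (α := (α × ℕ) × ℕ) .snd)))) (.const 1) (.const 0))

theorem PolyDec.below (hi : PolyTime i) (hj : PolyTime j) :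
    PolyDec (fun a => (sc a).Below (i a) (j a)) :=
  .and (.ball (P := fun a x => (sc a).d (i a) x = 1 → (sc a).d (j a) x = 1) .m
    (.imp (.d hi.fst .snd) (.d hj.fst .snd))) (.lt (.const 0) (Small.card hi).1)

theorem PolyTime.val (hi : PolyTime i) : PolyTime (fun a => (sc a).val (i a)) :=
  .sum (f := fun a x => if (sc a).Below x (i a) then (sc a).Z x else 0) .n
    (.ite (.below (α := α × ℕ) .snd hi.fst) (.Z (α := α × ℕ) .snd) (.const 0))

theorem PolyTime.bud (hi : PolyTime i) : PolyTime (fun a => (sc a).bud (i a)) :=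
  .sum (f := fun a x => if (sc a).Below x (i a) then (sc a).β x else 0) .n
    (.ite (.below (α := α × ℕ) .snd hi.fst) (.β (α := α × ℕ) .snd) (.const 0))

theorem PolyTime.cst (hi : PolyTime i) : PolyTime (fun a => (sc a).cst (i a)) :=
  .sum (f := fun a x => if (sc a).d (i a) x = 1 then (sc a).C x else 0) .m
    (.ite (.d hi.fst .snd) (.C (α := α × ℕ) .snd) (.const 0))

theorem PolyTime.mask (hi : PolyTime i) : PolyTime (fun a => (sc a).mask (i a)) :=
  .sum (f := fun a x => if (sc a).d (i a) x = 1 then 2 ^ x else 0) .m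
    (.ite (.d hi.fst .snd) (.two_pow .snd) (.const 0))

theorem PolyTime.gain (hi : PolyTime i) : PolyTime (fun a => (sc a).gain (i a)) :=
  (PolyTime.val hi).sub (.cst hi)

theorem PolyTime.offset : PolyTime (fun a : α => (sc a).offset) :=
  (PolyTime.sum (f := fun a x => (sc a).C x) .m (.C (α := α × ℕ) .snd)).add (.const 1)

theorem PolyTime.wt (hg : PolyTime g) (hi : PolyTime i) :
    PolyTime (fun a => (sc a).wt (g a) (i a)) :=
  (((PolyTime.gain hi).mul Small.n.1).mul Small.k.1).div (.gain hg)

theorem Small.cols : Small (fun a : α => (sc a).cols) :=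
  ((Small.n.mul .n).mul .k).add (.const 1)

theorem PolyDec.adm (hg : PolyTime g) (hi : PolyTime i) :
    PolyDec (fun a => (sc a).Adm (g a) (i a)) :=
  .and (.lt (.cst hi) (.val hi)) (.le (.gain hi) (.gain hg))

theorem PolyTime.entry {t B X : α → ℕ} (hg : PolyTime g) (ht : Small t) (hB : PolyTime B)
    (hX : PolyTime X) : PolyTime (fun a => (sc a).entry (g a) (t a) (RAM.digit (B a) (X a))) := by
  have htm : Small (fun a => t a % (sc a).cols) :=
    .of_le (ht.1.mod Small.cols.1) ht.2 fun a => Nat.mod_le _ _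
  have hread : PolyTime (fun p : α × ℕ => RAM.digit (B p.1) (X p.1)
      ((sc p.1).lo p.2 * (sc p.1).cols + (t p.1 % (sc p.1).cols - (sc p.1).wt (g p.1) p.2))) :=
    .digit hB.fst hX.fst (((Small.lo (α := α × ℕ) .snd).mul .cols).add
      (htm.fst.sub (.wt (α := α × ℕ) hg.fst .snd)))
  refine .ite (.lt ht.1 Small.cols.1) (.ite (.eq ht.1 (.const 0))
    (.mul .offset (.two_pow .m)) (.const 0)) (.max (.digit hB hX (ht.sub Small.cols.1)) ?_)
  refine .sup .n (.ite (.and (.eq (Small.hi (α := α × ℕ) .snd).1 (ht.1.div Small.cols.1).fst)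
    (.and (.adm (α := α × ℕ) hg.fst .snd) (.and (.le (.wt (α := α × ℕ) hg.fst .snd) htm.1.fst)
      (.not (.eq hread (.const 0)))))) (.sub (.add hread (.add (.mul (.bud (α := α × ℕ) .snd)
        (.two_pow Small.m.fst)) (.mask (α := α × ℕ) .snd))) (.mul (.cst (α := α × ℕ) .snd)
        (.two_pow Small.m.fst))) (.const 0))

/-- The growth bound for the recursion: an entry is the initial one, an earlier one, or an earlier
one plus the term of a single agent. The bound adds up all these terms and so does not depend on `t`
or `g`. -/
theorem entry_le (P : Scaled) (g t M : ℕ) (r : ℕ → ℕ) (h : ∀ u, r u ≤ M) :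
    P.entry g t r ≤ M + (P.offset * 2 ^ P.m +
      ∑ i ∈ range P.n, (P.bud i * 2 ^ P.m + P.mask i)) := by
  rw [Scaled.entry]
  split_ifs
  · omega
  · omega
  · refine max_le ((h _).trans (Nat.le_add_right _ _)) (Finset.sup_le fun i hi => ?_)
    have h1 : P.bud i * 2 ^ P.m + P.mask i ≤ ∑ i ∈ range P.n, (P.bud i * 2 ^ P.m + P.mask i) :=
      single_le_sum (f := fun i => P.bud i * 2 ^ P.m + P.mask i) (fun _ _ => Nat.zero_le _) hi
    split_ifs
    · have := h (P.lo i * P.cols + (t % P.cols - P.wt g i))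
      omega
    · exact Nat.zero_le _

/-- The last row begins at index `m * cols`, which is polynomial in value because the accuracy is
counted by its value. -/
theorem PolyTime.lastRow {q : α → ℕ} (hg : PolyTime g) (hq : Small q) :
    PolyTime (fun a => (sc a).cell (g a) (sc a).m (q a)) := by
  have ht : Small (fun a => (sc a).m * (sc a).cols + q a) := (Small.m.mul .cols).add hq
  refine PolyTime.recTable (g := fun a => (sc a).entry (g a)) (ht.add (.const 1))
    (.add (.mul .offset (.two_pow .m)) (.sum .n (.add (.mul (.bud (α := α × ℕ) .snd)
      (.two_pow Small.m.fst)) (.mask (α := α × ℕ) .snd)))) ht.1 (fun a => Nat.lt_succ_self _)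
    (fun B hB => PolyTime.entry (α := (α × ℕ) × Word) hg.fst.fstWord Small.snd.fstWord
      hB.fst.fstWord .word) fun a t r M _ h => entry_le _ _ _ _ _ h

theorem PolyDec.bit (hw : PolyTime w) (hj : Small j) : PolyDec (fun a => w a / 2 ^ j a % 2 = 1) :=
  .eq (.mod (.div hw (.two_pow hj)) (.const 2)) (.const 1)

theorem PolyDec.sat (hi : PolyTime i) (hw : PolyTime w) :
    PolyDec (fun a => (sc a).Sat (i a) (w a)) :=
  .ball (P := fun a j => (sc a).d (i a) j = 1 → w a / 2 ^ j % 2 = 1) .m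
    (.imp (.d hi.fst .snd) (.bit hw.fst .snd))

theorem PolyTime.maskVal (hw : PolyTime w) : PolyTime (fun a => (sc a).maskVal (w a)) :=
  .sum (f := fun a x => if (sc a).Sat x (w a) then (sc a).Z x else 0) .n
    (.ite (.sat (α := α × ℕ) .snd hw.fst) (.Z (α := α × ℕ) .snd) (.const 0))

theorem PolyTime.maskBud (hw : PolyTime w) : PolyTime (fun a => (sc a).maskBud (w a)) :=
  .sum (f := fun a x => if (sc a).Sat x (w a) then (sc a).β x else 0) .n
    (.ite (.sat (α := α × ℕ) .snd hw.fst) (.β (α := α × ℕ) .snd) (.const 0))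

theorem PolyTime.maskCst (hw : PolyTime w) : PolyTime (fun a => (sc a).maskCst (w a)) :=
  .sum (f := fun a x => if w a / 2 ^ x % 2 = 1 then (sc a).C x else 0) .m
    (.ite (.bit hw.fst .snd) (.C (α := α × ℕ) .snd) (.const 0))

theorem PolyTime.cand (hw : PolyTime w) : PolyTime (fun a => (sc a).cand (w a)) :=
  .ite (.le (.maskCst hw) (.maskBud hw))
    (.add (.mul (.sub (.maskVal hw) (.maskCst hw)) (.two_pow .m)) hw) (.const 0)

theorem PolyTime.best : PolyTime (fun a : α => (sc a).best) :=
  .max (.mul (.maskVal (.const 0)) (.two_pow .m))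
    (.sup (f := fun a g => (range (sc a).cols).sup fun q =>
        (sc a).cand ((sc a).cell g (sc a).m q % 2 ^ (sc a).m)) .n
      (.sup (f := fun (p : α × ℕ) q =>
        (sc p).cand ((sc p).cell p.2 (sc p).m q % 2 ^ (sc p).m)) .cols
        (.cand (α := (α × ℕ) × ℕ) (.mod (.lastRow (α := (α × ℕ) × ℕ) (.fst .snd) .snd)
          (.two_pow (Small.m (α := (α × ℕ) × ℕ)))))))

theorem PolyTime.out : PolyTime (fun a : α => (sc a).out) :=
  .mod .best (.two_pow .m)

theorem PolyTime.pay (hi : Small i) : PolyTime (fun a => (sc a).pay (i a)) :=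
  .ite (.sat hi.1 .out) (.min (.β hi.1) (.sub (.maskCst .out)
    (.sum (f := fun a x => if (sc a).Sat x (sc a).out then (sc a).β x else 0) hi
      (.ite (.sat (α := α × ℕ) .snd (PolyTime.fst .out)) (.β (α := α × ℕ) .snd) (.const 0)))))
    (.const 0)

end RAM

namespace RAM

open Ctx Classical

/-- The algorithm as a program. -/
theorem exists_program : ∃ (p : Cmd) (K : ℕ), ∀ q : Query, ∃ t s,
    Exec p (q.inst.input q.acc) t s ∧
      (∀ j < q.inst.m, s.arr 7 j = if q.scaled.out / 2 ^ j % 2 = 1 then 1 else 0) ∧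
      (∀ i < q.inst.n, s.arr 8 i = q.scaled.pay i) ∧ (∀ i < q.inst.n, s.arr 9 i = q.den) ∧
      t ≤ (q.inst.size + q.acc + 2) ^ K := by
  obtain ⟨p₁, T₁, hT₁, h₁⟩ := PolyTime.fill
    (f := fun q j => if (sc q).out / 2 ^ j % 2 = 1 then 1 else 0) Small.projects
    (.ite (.bit (PolyTime.out (α := Query)).fst .snd) (.const 1) (.const 0)) 7 le_rfl
  obtain ⟨p₂, T₂, hT₂, h₂⟩ := PolyTime.fill (f := fun q i => (sc q).pay i)
    Small.agents (.pay (α := Query × ℕ) .snd) 8 (by omega)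
  obtain ⟨p₃, T₃, hT₃, h₃⟩ := PolyTime.fill (f := fun q _ => q.den)
    Small.agents (PolyTime.den (α := Query × ℕ)) 9 (by omega)
  obtain ⟨K, hK⟩ := hT₁.add (hT₂.add hT₃)
  -- Each of the three passes writes to one output array only, so the later ones still find the
  -- input and preserve the earlier output.
  refine ⟨.seq p₁ (.seq p₂ p₃), K, fun q => ?_⟩
  obtain ⟨t₁, s₁, e₁, H₁, v₁, -, c₁⟩ := h₁ q (q.inst.input q.acc)
    ⟨rfl, fun _ _ => rfl, fun _ _ => rfl⟩
  obtain ⟨t₂, s₂, e₂, H₂, v₂, a₂, c₂⟩ := h₂ q s₁ H₁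
  obtain ⟨t₃, s₃, e₃, -, v₃, a₃, c₃⟩ := h₃ q s₂ H₂
  refine ⟨_, s₃, .seq e₁ (.seq e₂ e₃), fun j hj => ?_, fun i hi => ?_, v₃, ?_⟩
  · rw [a₃ 7 (by omega), a₂ 7 (by omega)]
    exact v₁ j hj
  · rw [a₃ 8 (by omega)]
    exact v₂ i hi
  · refine le_trans ?_ (hK q)
    show _ ≤ T₁ q + (T₂ q + T₃ q)
    omega

end RAM

/-! ## Outcomes -/

namespace Scaled

/-- Collecting a total of `c` from contributors with limits `u`, one after the other. -/
def collect (u : ℕ → ℕ) (c i : ℕ) : ℕ := min (u i) (c - ∑ a ∈ range i, u a)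

/-- The first `t` contributors together pay the minimum of `c` and the sum of their limits. -/
theorem sum_collect {u : ℕ → ℕ} {c n : ℕ} (h : c ≤ ∑ a ∈ range n, u a) :
    ∑ i ∈ range n, collect u c i = c := by
  have : ∀ t, ∑ i ∈ range t, collect u c i = min c (∑ a ∈ range t, u a) := by
    intro t
    induction t with
    | zero => simp
    | succ t ih => rw [sum_range_succ, sum_range_succ, ih, collect]; omega
  rw [this, min_eq_left h]

end Scaled

/-! ### The scaled instance represents the rational one -/

namespace RAM.Query

variable (q : Query)

open Classical

theorem cell_val (i : Fin q.inst.n) : q.cell 0 i = (q.inst.z i).num ∧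
    q.cell 1 i = (q.inst.z i).den ∧ q.cell 2 i = (q.inst.b i).num ∧
    q.cell 3 i = (q.inst.b i).den := by
  simp [cell, SingleMinded.input, ofFin]

theorem cell_cost (j : Fin q.inst.m) : q.cell 4 j = (q.inst.C j).num ∧
    q.cell 5 j = (q.inst.C j).den := by
  simp [cell, SingleMinded.input, ofFin]

theorem den_pos : 0 < q.den := by
  refine Nat.mul_pos (prod_pos fun i hi => ?_) (prod_pos fun j hj => ?_)
  · obtain ⟨-, h1, -, h3⟩ := q.cell_val ⟨i, mem_range.1 hi⟩
    simp only at h1 h3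
    rw [h1, h3]
    exact Nat.mul_pos (NNRat.den_pos _) (NNRat.den_pos _)
  · have h := (q.cell_cost ⟨j, mem_range.1 hj⟩).2
    simp only at h
    rw [h]
    exact NNRat.den_pos _

theorem scale_eq {x : ℚ≥0} {δ : ℕ} (h : x.den ∣ δ) :
    ((x.num * (δ / x.den) : ℕ) : ℝ) = (x : ℝ) * δ := by
  obtain ⟨r, rfl⟩ := h
  have hx : (x.den : ℝ) ≠ 0 := by exact_mod_cast (NNRat.den_pos x).ne'
  rw [Nat.mul_div_cancel_left _ (NNRat.den_pos x), NNRat.cast_def x]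
  push_cast
  field_simp

theorem Z_eq (i : Fin q.inst.n) : (q.scaled.Z i : ℝ) = (q.inst.z i : ℝ) * q.den := by
  obtain ⟨h0, h1, -, -⟩ := q.cell_val i
  show ((q.cell 0 i * (q.den / q.cell 1 i) : ℕ) : ℝ) = _
  rw [h0, h1]
  refine scale_eq (Dvd.dvd.mul_right ?_ _)
  rw [← h1]
  exact (dvd_mul_right _ _).trans
    (dvd_prod_of_mem (fun i => q.cell 1 i * q.cell 3 i) (mem_range.2 i.2))

theorem β_eq (i : Fin q.inst.n) :
    (q.scaled.β i : ℝ) = min (q.inst.z i : ℝ) (q.inst.b i : ℝ) * q.den := by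
  obtain ⟨-, -, h2, h3⟩ := q.cell_val i
  show ((min (q.scaled.Z i) (q.cell 2 i * (q.den / q.cell 3 i)) : ℕ) : ℝ) = _
  rw [h2, h3, Nat.cast_min, Z_eq, scale_eq, min_mul_of_nonneg _ _ (Nat.cast_nonneg _)]
  refine Dvd.dvd.mul_right ?_ _
  rw [← h3]
  exact (dvd_mul_left _ _).trans
    (dvd_prod_of_mem (fun i => q.cell 1 i * q.cell 3 i) (mem_range.2 i.2))

theorem C_eq (j : Fin q.inst.m) : (q.scaled.C j : ℝ) = (q.inst.C j : ℝ) * q.den := by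
  obtain ⟨h4, h5⟩ := q.cell_cost j
  show ((q.cell 4 j * (q.den / q.cell 5 j) : ℕ) : ℝ) = _
  rw [h4, h5]
  refine scale_eq (Dvd.dvd.mul_left ?_ _)
  rw [← h5]
  exact dvd_prod_of_mem (fun j => q.cell 5 j) (mem_range.2 j.2)

/-- The matrix is stored row by row; since column indices are below `m`, a cell number determines
its column as a remainder and then its row. -/
theorem D_eq (i : Fin q.inst.n) : q.scaled.D i = (q.inst.D i).map Fin.valEmbedding := by
  ext x
  rw [Scaled.mem_D, mem_map]
  show x < q.inst.m ∧ (if _ then 1 else 0) = 1 ↔ _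
  constructor
  · rintro ⟨hx, h⟩
    obtain ⟨i', j', h1, h2⟩ : ∃ (i' : Fin q.inst.n) (j' : Fin q.inst.m),
        (i : ℕ) * q.inst.m + x = (i' : ℕ) * q.inst.m + (j' : ℕ) ∧ j' ∈ q.inst.D i' := by
      by_contra hc
      rw [if_neg hc] at h
      omega
    have hm : x = j' := by
      have := congrArg (· % q.inst.m) h1
      simpa [Nat.mul_add_mod_of_lt, Nat.mod_eq_of_lt hx, Nat.mul_add_mod', Nat.mod_eq_of_lt j'.2]
        using this
    have hi : (i : ℕ) = i' := by
      rw [hm] at h1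
      exact Nat.eq_of_mul_eq_mul_right (by omega) (Nat.add_right_cancel h1)
    rw [← Fin.ext hi] at h2
    exact ⟨j', h2, hm.symm⟩
  · rintro ⟨j, hj, rfl⟩
    exact ⟨j.2, if_pos ⟨i, j, rfl, hj⟩⟩

theorem isLaminar (h : q.inst.Laminar) : q.scaled.IsLaminar := by
  intro i hi i' hi'
  have h1 := q.D_eq ⟨i, hi⟩
  have h2 := q.D_eq ⟨i', hi'⟩
  simp only at h1 h2
  rw [h1, h2, ← map_inter]
  rcases h ⟨i, hi⟩ ⟨i', hi'⟩ with h | h | h <;> rw [h] <;> simp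

/-- A bundle as a set of numbers. -/
def bundle (W : Finset (Fin q.inst.m)) : Finset ℕ := W.map Fin.valEmbedding

/-- The scaled cost of a bundle. -/
def bundleCost (W : Finset (Fin q.inst.m)) : ℕ := ∑ j ∈ q.bundle W, q.scaled.C j

variable {q}

theorem D_subset_bundle {i : Fin q.inst.n} {W : Finset (Fin q.inst.m)} :
    q.scaled.D i ⊆ q.bundle W ↔ q.inst.D i ⊆ W := by
  rw [D_eq, bundle, map_subset_map]

theorem cost_eq (W : Finset (Fin q.inst.m)) :
    (q.bundleCost W : ℝ) = q.inst.toInstance.cost W * q.den := by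
  rw [bundleCost, bundle, sum_map, PBInstance.cost, sum_mul]
  push_cast
  exact sum_congr rfl fun j _ => q.C_eq j

theorem satSum_eq (f : ℕ → ℕ) (W : Finset (Fin q.inst.m)) :
    q.scaled.satSum f (q.bundle W) = ∑ i : Fin q.inst.n, if q.inst.D i ⊆ W then f i else 0 := by
  rw [Scaled.satSum]
  show ∑ a ∈ range q.inst.n, _ = _
  rw [sum_range]
  simp only [D_subset_bundle]

theorem value_eq (W : Finset (Fin q.inst.m)) :
    (q.scaled.satSum q.scaled.Z (q.bundle W) : ℝ) =
      (∑ i, q.inst.toInstance.v i W) * q.den := by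
  rw [satSum_eq, sum_mul]
  push_cast
  refine sum_congr rfl fun i _ => ?_
  simp only [SingleMinded.toInstance]
  split_ifs
  · exact q.Z_eq i
  · simp

/-! ### Outcomes and affordable bundles -/

/-- The welfare of an outcome is bounded by value minus cost, and its bundle is affordable. -/
theorem welfare_le {o : PBOutcome q.inst.n q.inst.m} (hf : q.inst.toInstance.Feasible o)
    (hw : q.inst.toInstance.WP o) :
    q.bundleCost o.W ≤ q.scaled.satSum q.scaled.β (q.bundle o.W) ∧
      q.inst.toInstance.SW o * q.den ≤
        (q.scaled.satSum q.scaled.Z (q.bundle o.W) : ℝ) - q.bundleCost o.W := by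
  have hδ : (0 : ℝ) < q.den := by exact_mod_cast q.den_pos
  obtain ⟨hb, hbal⟩ := hf
  rw [PBInstance.WBB] at hbal
  constructor
  · have : (q.bundleCost o.W : ℝ) ≤ q.scaled.satSum q.scaled.β (q.bundle o.W) := by
      rw [cost_eq, satSum_eq]
      push_cast
      refine (mul_le_mul_of_nonneg_right hbal hδ.le).trans ?_
      rw [sum_mul]
      refine sum_le_sum fun i _ => ?_
      have h1 := hw i
      have h2 := hb i
      simp only [PBInstance.utility, SingleMinded.toInstance] at h1 h2
      split_ifs at h1 ⊢ with h
      · rw [β_eq]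
        exact mul_le_mul_of_nonneg_right (le_min (by linarith) h2) hδ.le
      -- An agent whose demand set is not funded has value zero, so weak participation forces a
      -- nonpositive payment.
      · exact mul_nonpos_of_nonpos_of_nonneg (by linarith) hδ.le
    exact_mod_cast this
  · rw [cost_eq, value_eq, ← sub_mul]
    refine mul_le_mul_of_nonneg_right ?_ hδ.le
    simp only [PBInstance.SW, PBInstance.utility, sum_sub_distrib]
    linarith

/-- The outcome with the funded projects `W` and the scaled payments `x`. -/
noncomputable def outcome (W : Finset (Fin q.inst.m)) (x : ℕ → ℕ) : PBOutcome q.inst.n q.inst.m :=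
  ⟨W, fun i => (x i : ℝ) / (q.den : ℝ)⟩

/-- The cap `β` is the scaled `min z_i b_i`, so one bound on the payments gives both the budget
constraint and weak participation. Payments that sum to the cost exactly make the welfare equal to
value minus cost. -/
theorem outcome_spec {W : Finset (Fin q.inst.m)} {x : ℕ → ℕ}
    (hx : ∀ i : Fin q.inst.n, x i ≤ if q.inst.D i ⊆ W then q.scaled.β i else 0)
    (hs : ∑ i ∈ range q.inst.n, x i = q.bundleCost W) :
    q.inst.toInstance.Feasible (outcome W x) ∧ q.inst.toInstance.WP (outcome W x) ∧
      q.inst.toInstance.SW (outcome W x) * q.den =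
        (q.scaled.satSum q.scaled.Z (q.bundle W) : ℝ) - q.bundleCost W := by
  have hδ : (0 : ℝ) < q.den := by exact_mod_cast q.den_pos
  have hx' : ∀ i : Fin q.inst.n, (x i : ℝ) / q.den ≤
      if q.inst.D i ⊆ W then min (q.inst.z i : ℝ) (q.inst.b i : ℝ) else 0 := fun i => by
    have h1 : (x i : ℝ) ≤ ((if q.inst.D i ⊆ W then q.scaled.β i else 0 : ℕ) : ℝ) := by
      exact_mod_cast hx i
    rw [div_le_iff₀ hδ]
    refine h1.trans ?_
    split_ifs
    · exact (q.β_eq i).le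
    · simp
  have hsum : (∑ i : Fin q.inst.n, (x i : ℝ) / q.den) * q.den = q.bundleCost W := by
    rw [← hs, sum_range, ← sum_div, div_mul_cancel₀ _ hδ.ne']
    push_cast
    rfl
  refine ⟨⟨fun i => (hx' i).trans ?_, ?_⟩, fun i => ?_, ?_⟩
  · split_ifs
    · exact min_le_right _ _
    · exact NNRat.cast_nonneg _
  · refine le_of_mul_le_mul_right ?_ hδ
    refine le_trans ?_ hsum.ge
    exact (cost_eq W).ge
  · rw [PBInstance.utility, sub_nonneg]
    refine (hx' i).trans ?_
    simp only [SingleMinded.toInstance, outcome]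
    split_ifs
    · exact min_le_left _ _
    · exact le_rfl
  · rw [value_eq, ← hsum, ← sub_mul]
    simp only [PBInstance.SW, PBInstance.utility, sum_sub_distrib, outcome]

/-- An affordable bundle can be financed. -/
theorem exists_outcome {W : Finset (Fin q.inst.m)}
    (h : q.bundleCost W ≤ q.scaled.satSum q.scaled.β (q.bundle W)) :
    ∃ o : PBOutcome q.inst.n q.inst.m, q.inst.toInstance.Feasible o ∧ q.inst.toInstance.WP o ∧
      q.inst.toInstance.SW o * q.den =
        (q.scaled.satSum q.scaled.Z (q.bundle W) : ℝ) - q.bundleCost W := by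
  refine ⟨_, outcome_spec (W := W) (x := Scaled.collect
    (fun a => if q.scaled.D a ⊆ q.bundle W then q.scaled.β a else 0) (q.bundleCost W))
    (fun i => (min_le_left _ _).trans ?_) (Scaled.sum_collect h)⟩
  simp only [D_subset_bundle, le_refl]

theorem β_le_Z (i : ℕ) : q.scaled.β i ≤ q.scaled.Z i := min_le_left _ _

theorem cost_le_value {W : Finset ℕ} {c : ℕ} (h : c ≤ q.scaled.satSum q.scaled.β W) :
    c ≤ q.scaled.satSum q.scaled.Z W :=
  h.trans (sum_le_sum fun a _ => by
    split_ifs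
    · exact β_le_Z a
    · exact le_rfl)

/-- A welfare-optimal outcome exists. -/
theorem exists_optimal (q : Query) : ∃ (opt : PBOutcome q.inst.n q.inst.m)
    (W : Finset (Fin q.inst.m)), q.inst.toInstance.IsUWOWP opt ∧
      q.bundleCost W ≤ q.scaled.satSum q.scaled.β (q.bundle W) ∧
      q.inst.toInstance.SW opt * q.den =
        (q.scaled.satSum q.scaled.Z (q.bundle W) : ℝ) - q.bundleCost W := by
  have hδ : (0 : ℝ) < q.den := by exact_mod_cast q.den_pos
  -- There are finitely many bundles, so the maximum is attained although payments range over the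
  -- reals; the empty bundle is affordable.
  obtain ⟨W, hW, hmax⟩ := exists_max_image
    {W : Finset (Fin q.inst.m) | q.bundleCost W ≤ q.scaled.satSum q.scaled.β (q.bundle W)}
    (fun W => (q.scaled.satSum q.scaled.Z (q.bundle W) : ℝ) - q.bundleCost W)
    ⟨∅, by simp [bundleCost, bundle]⟩
  simp only [mem_filter, mem_univ, true_and] at hW hmax
  obtain ⟨o, hf, hw, hs⟩ := exists_outcome hW
  refine ⟨o, W, ⟨hf, hw, fun o' hf' hw' => ?_⟩, hW, hs⟩
  obtain ⟨h1, h2⟩ := welfare_le hf' hw'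
  refine le_of_mul_le_mul_right ?_ hδ
  rw [hs]
  exact h2.trans (hmax _ h1)

/-! ### The outcome computed by the algorithm -/

variable (q) in
/-- The projects funded by the algorithm. -/
noncomputable def funded : Finset (Fin q.inst.m) := {j | q.scaled.out / 2 ^ (j : ℕ) % 2 = 1}

theorem bundle_funded : q.bundle q.funded = q.scaled.bitSet q.scaled.out := by
  ext x
  simp only [bundle, funded, mem_map, mem_filter, mem_univ, true_and, Scaled.bitSet, mem_range]
  constructor
  · rintro ⟨j, hj, rfl⟩
    exact ⟨j.2, hj⟩
  · rintro ⟨hx, h⟩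
    exact ⟨⟨x, hx⟩, h, rfl⟩

theorem pay_eq (i : ℕ) : q.scaled.pay i = Scaled.collect
    (fun a => if q.scaled.Sat a q.scaled.out then q.scaled.β a else 0)
    (q.scaled.maskCst q.scaled.out) i := by
  rw [Scaled.pay, Scaled.collect]
  split_ifs <;> simp

/-- The outcome of the algorithm. -/
theorem funded_spec (q : Query) :
    q.inst.toInstance.Feasible (outcome q.funded q.scaled.pay) ∧
      q.inst.toInstance.WP (outcome q.funded q.scaled.pay) ∧
      q.inst.toInstance.SW (outcome q.funded q.scaled.pay) * q.den =
        ((q.scaled.maskVal q.scaled.out - q.scaled.maskCst q.scaled.out : ℕ) : ℝ) := by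
  have hC : q.bundleCost q.funded = q.scaled.maskCst q.scaled.out := by
    rw [bundleCost, bundle_funded, Scaled.maskCst_eq]
  have hle := (Scaled.out_spec (P := q.scaled)).1
  obtain ⟨h1, h2, h3⟩ := outcome_spec (q := q) (W := q.funded) (x := q.scaled.pay)
    (fun i => by
      rw [pay_eq]
      refine (min_le_left _ _).trans ?_
      simp only [Scaled.sat_iff, ← bundle_funded, D_subset_bundle, le_refl])
    (by
      rw [hC]
      simp only [pay_eq]
      exact Scaled.sum_collect hle)
  refine ⟨h1, h2, h3.trans ?_⟩
  rw [hC, bundle_funded, ← Scaled.maskVal_eq, Nat.cast_sub]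
  rw [Scaled.maskVal_eq]
  exact cost_le_value (by rwa [← Scaled.maskBud_eq])

/-- The loss is at most the optimal welfare divided by the accuracy, and the accuracy is at least `1
/ ε`; the common denominator cancels. -/
theorem welfare_approx (q : Query) (hI : q.inst.Laminar) {ε : ℝ} (hε : 0 < ε)
    (hk : 1 / ε ≤ q.acc) : ∃ opt : PBOutcome q.inst.n q.inst.m,
      q.inst.toInstance.IsUWOWP opt ∧ (1 - ε) * q.inst.toInstance.SW opt ≤
        q.inst.toInstance.SW (outcome q.funded q.scaled.pay) := by
  have hδ : (0 : ℝ) < q.den := by exact_mod_cast q.den_pos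
  obtain ⟨opt, W, hopt, hW, hs⟩ := exists_optimal q
  refine ⟨opt, hopt, le_of_mul_le_mul_right ?_ hδ⟩
  have key := Scaled.approx (q.isLaminar hI) (fun i => β_le_Z i) hW
  change q.acc * (_ - q.bundleCost W) ≤ q.acc * _ + (_ - q.bundleCost W) at key
  rw [mul_assoc, hs, (funded_spec q).2.2, ← Nat.cast_sub (cost_le_value hW)]
  generalize q.scaled.satSum q.scaled.Z (q.bundle W) - q.bundleCost W = x at key
  generalize q.scaled.maskVal q.scaled.out - q.scaled.maskCst q.scaled.out = y at key
  have key' : (q.acc : ℝ) * x ≤ q.acc * y + x := by exact_mod_cast key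
  have hk0 : (0 : ℝ) < q.acc := (one_div_pos.2 hε).trans_le hk
  have h1 : 1 ≤ (q.acc : ℝ) * ε := by rwa [div_le_iff₀ hε] at hk
  refine le_of_mul_le_mul_left ?_ hk0
  have hx : (0 : ℝ) ≤ x := Nat.cast_nonneg _
  nlinarith [mul_le_mul_of_nonneg_right h1 hx]

end RAM.Query

theorem mainTheorem1 :
    ∃ (A : RAM.Cmd) (c d : ℕ),
      ∀ I : SingleMinded, I.Laminar → ∀ ε : ℝ, 0 < ε →
        ∃ (t : ℕ) (s : RAM.Store) (o : PBOutcome I.n I.m),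
          RAM.Exec A (I.input ⌈1 / ε⌉₊) t s ∧
          (t : ℝ) ≤ c * ((I.size : ℝ) + 1 / ε + 1) ^ d ∧
          I.IsOutput s o ∧
          I.toInstance.Feasible o ∧
          I.toInstance.WP o ∧
          ∃ opt : PBOutcome I.n I.m,
            I.toInstance.IsUWOWP opt ∧
            (1 - ε) * I.toInstance.SW opt ≤ I.toInstance.SW o := by
  obtain ⟨p, K, hp⟩ := RAM.exists_program
  -- Rounding up adds at most one, and `|I| + 1 / ε + 3 ≤ 3 * (|I| + 1 / ε + 1)`, whence the factor
  -- `3 ^ K`.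
  refine ⟨p, 3 ^ K, K, fun I hI ε hε => ?_⟩
  let q : RAM.Query := ⟨I, ⌈1 / ε⌉₊⟩
  obtain ⟨t, s, he, h7, h8, h9, ht⟩ := hp q
  obtain ⟨hf, hw, -⟩ := RAM.Query.funded_spec q
  refine ⟨t, s, RAM.Query.outcome (q := q) q.funded q.scaled.pay, he, ?_,
    ⟨fun j => ?_, fun i => ?_⟩,
    hf, hw, RAM.Query.welfare_approx q hI hε (Nat.le_ceil _)⟩
  · have h1 : (t : ℝ) ≤ ((I.size : ℝ) + ⌈1 / ε⌉₊ + 2) ^ K := by exact_mod_cast ht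
    have hpos : 0 < 1 / ε := one_div_pos.2 hε
    have h2 := (Nat.ceil_lt_add_one hpos.le).le
    refine h1.trans ?_
    push_cast
    rw [← mul_pow]
    refine pow_le_pow_left₀ (by positivity) ?_ _
    have : (0 : ℝ) ≤ I.size := Nat.cast_nonneg _
    linarith
  · rw [h7 j j.2]
    simp [RAM.Query.outcome, RAM.Query.funded]
  · rw [h8 i i.2, h9 i i.2]
    exact ⟨q.den_pos.ne', rfl⟩
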